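/- An abstract simplicial complex $\Delta$ of dimension $d-1$ is \emph{balanced} if its vertices can be colored with $d$ colors so that no face contains two vertices of the same color. It is a \emph{simplicial manifold} if its geometric realization $\|\Delta\|$ is a $(d-1)$-dimensional topological manifold (without boundary), and it \emph{triangulates} a space $X$ if $\|\Delta\|$ is homeomorphic to $X$. The nonorientable $\mathbb{S}^{n}$-bundle over $\mathbb{S}^1$ ($n\ge 1$) is the quotient of $\mathbb{S}^{n}\times[0,1]$ by the identifications $(x,0)\sim(\rho(x),1)$, where $\rho$ is the reflection of $\mathbb{S}^n$ that changes the sign of the first coordinate. \textbf{Theorem.} For all $d\ge 3$ and $k\ge 2$ there exists a balanced simplicial manifold $\Delta_{k,d}$ of dimension $d-1$ with exactly $3d+k$ vertices that triangulates $\mathbb{S}^{d-2}\times\mathbb{S}^1$, and there exists a balanced simplicial manifold $\widetilde{\Delta}_{k,d}$ of dimension $d-1$ with exactly $3d+k$ vertices that triangulates the nonorientable $\mathbb{S}^{d-2}$-bundle over $\mathbb{S}^1$. -/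

import Mathlib

/-- The geometric realization `‖K‖` of a finite abstract simplicial complex, in barycentric
coordinates: the points of the standard simplex on the vertex set whose support lies in a face,
with the subspace topology from `V → ℝ`. -/
def AbstractSimplicialComplex.realization {V : Type*} [Fintype V]
    (K : AbstractSimplicialComplex V) : Set (V → ℝ) :=
  {x | x ∈ stdSimplex ℝ V ∧ ∃ s ∈ K.faces, ∀ v, v ∉ s → x v = 0}

/-- `K` has dimension `n`: some face has `n + 1` vertices, and no face has more. -/
def AbstractSimplicialComplex.HasDim {V : Type*} (K : AbstractSimplicialComplex V) (n : ℕ) :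
    Prop :=
  (∃ s ∈ K.faces, s.card = n + 1) ∧ ∀ s ∈ K.faces, s.card ≤ n + 1

/-- `K` is an `n`-dimensional balanced complex: it has dimension `n`, and its vertices can be
coloured with `n + 1` colours so that no face contains two vertices of the same colour. -/
def AbstractSimplicialComplex.IsBalanced {V : Type*} (K : AbstractSimplicialComplex V) (n : ℕ) :
    Prop :=
  K.HasDim n ∧ ∃ κ : V → Fin (n + 1), ∀ s ∈ K.faces, Set.InjOn κ (s : Set V)

/-- A topological `n`-manifold without boundary: Hausdorff, second countable, and locally
homeomorphic to Euclidean `n`-space. -/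
def IsTopManifold (n : ℕ) (X : Type*) [TopologicalSpace X] : Prop :=
  T2Space X ∧ SecondCountableTopology X ∧
    ∀ x : X, ∃ e : OpenPartialHomeomorph X (EuclideanSpace ℝ (Fin n)), x ∈ e.source

/-- `K` is a simplicial `n`-manifold: an `n`-dimensional complex whose geometric realization is
an `n`-manifold. -/
def AbstractSimplicialComplex.IsSimplicialManifold {V : Type*} [Fintype V]
    (K : AbstractSimplicialComplex V) (n : ℕ) : Prop :=
  K.HasDim n ∧ IsTopManifold n K.realization

/-- `K` triangulates the space `X`: its geometric realization is homeomorphic to `X`. -/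
def AbstractSimplicialComplex.Triangulates {V : Type*} [Fintype V]
    (K : AbstractSimplicialComplex V) (X : Type*) [TopologicalSpace X] : Prop :=
  Nonempty (K.realization ≃ₜ X)

/-- The unit sphere `𝕊ⁿ` in Euclidean `(n + 1)`-space. -/
abbrev UnitSphere (n : ℕ) : Type :=
  Metric.sphere (0 : EuclideanSpace ℝ (Fin (n + 1))) 1

/-- The reflection of `𝕊ⁿ` that changes the sign of the first coordinate. -/
noncomputable def sphereReflection (n : ℕ) (x : UnitSphere n) : UnitSphere n :=
  ⟨WithLp.toLp 2 fun i => if i = 0 then -(x.1 i) else x.1 i, by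
    have hx : ‖x.1‖ = 1 := mem_sphere_zero_iff_norm.mp x.2
    refine mem_sphere_zero_iff_norm.mpr (Eq.trans ?_ hx)
    rw [EuclideanSpace.norm_eq, EuclideanSpace.norm_eq]
    congr 1
    refine Finset.sum_congr rfl fun i _ => ?_
    by_cases h : i = 0 <;> simp [h]⟩

/-- The mapping torus of `f : X → X`: the quotient of `X × [0, 1]` by the identifications
`(x, 0) ∼ (f x, 1)`, with the quotient topology. For a homeomorphism `f` it is the total space
of the bundle over `𝕊¹ = [0, 1] / (0 ∼ 1)` with fibre `X` and monodromy `f`. -/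
abbrev MappingTorus {X : Type*} (f : X → X) : Type _ :=
  Quot fun p q : X × unitInterval => p.2 = 0 ∧ q.2 = 1 ∧ q.1 = f p.1

/-- The nonorientable `𝕊ⁿ`-bundle over `𝕊¹` (for `n ≥ 1`): the bundle whose monodromy is a
reflection of `𝕊ⁿ`. -/
abbrev NonorientableSphereBundle (n : ℕ) : Type :=
  MappingTorus (sphereReflection n)

open Topology

/-!
Removing two opposite facets from the boundary of the `d`-dimensional cross-polytope leaves a
triangulated cylinder `𝕊ᵈ⁻² × [0, 1]` with `d` vertices at each end. Three such cylinders, glued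
cyclically with a permutation `σ` of the axes in the last gluing, triangulate a mapping torus of the
sphere `𝕊ᵈ⁻²` of the hyperplane `∑ xᵢ = 0` in `ℝᵈ`. Crossing a cylinder leads to the opposite facet,
which is the antipodal map, so the monodromy is `-σ`. It has sign `(-1) ^ (d - 1) * sign σ` and is
isotopic to the identity or to a reflection according to that sign.

For `σ = 1`, colouring each vertex by its axis is balanced and uses `3 * d` vertices; subdividing
an edge twice adds two. For a transposition `σ` there are exactly two edges whose endpoints have
the same colour, and one stellar subdivision of each repairs the colouring, again giving
`3 * d + 2` vertices. The parity of `d` decides which of the two yields the product and which the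
nonorientable bundle.

In both complexes there is a vertex `w` and a path `p q r s` in its link, coloured alternately with
two colours, such that the disc `w * pqrs` can be retriangulated with one more vertex. The new
complex again contains such a path, so every further number of vertices is reached.
-/

section LocallyEuclidean

/-- Every point has an open neighbourhood homeomorphic to an open subset of Euclidean `n`-space:
the last condition in `IsTopManifold`. -/
def IsLocallyEuclidean (n : ℕ) (X : Type*) [TopologicalSpace X] : Prop :=
  ∀ x : X, ∃ e : OpenPartialHomeomorph X (EuclideanSpace ℝ (Fin n)), x ∈ e.source

variable {n : ℕ} {X Z : Type*} [TopologicalSpace X] [TopologicalSpace Z]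

theorem IsLocallyEuclidean.prod_real (hX : IsLocallyEuclidean n X) :
    IsLocallyEuclidean (n + 1) (X × ℝ) := by
  rintro ⟨x, t⟩
  obtain ⟨e, he⟩ := hX x
  have L : (EuclideanSpace ℝ (Fin n) × ℝ) ≃L[ℝ] EuclideanSpace ℝ (Fin (n + 1)) :=
    ContinuousLinearEquiv.ofFinrankEq (by simp)
  exact ⟨(e.prod (OpenPartialHomeomorph.refl ℝ)).trans L.toHomeomorph.toOpenPartialHomeomorph,
    by simp [he]⟩

theorem IsLocallyEuclidean.of_isOpenEmbedding (hX : IsLocallyEuclidean n X) {f : Z → X}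
    (hf : IsOpenEmbedding f) : IsLocallyEuclidean n Z := by
  intro z
  obtain ⟨e, he⟩ := hX (f z)
  have : Nonempty Z := ⟨z⟩
  exact ⟨(hf.toOpenPartialHomeomorph f).trans e, by simp [he]⟩

theorem IsLocallyEuclidean.exists_chart (hZ : IsLocallyEuclidean n Z) {f : Z → X}
    (hf : IsOpenEmbedding f) (z : Z) :
    ∃ e : OpenPartialHomeomorph X (EuclideanSpace ℝ (Fin n)), f z ∈ e.source := by
  obtain ⟨e, he⟩ := hZ z
  have : Nonempty Z := ⟨z⟩
  exact ⟨(hf.toOpenPartialHomeomorph f).symm.trans e,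
    by simp [he, hf.toOpenPartialHomeomorph_left_inv]⟩

theorem isLocallyEuclidean_unitSphere (n : ℕ) : IsLocallyEuclidean n (UnitSphere n) := by
  intro x
  have : Fact (Module.finrank ℝ (EuclideanSpace ℝ (Fin (n + 1))) = n + 1) := ⟨by simp⟩
  exact ⟨chartAt (EuclideanSpace ℝ (Fin n)) x, mem_chart_source _ x⟩

end LocallyEuclidean

theorem isOpenEmbedding_comp_of_isQuotientMap {A B C : Type*} [TopologicalSpace A]
    [TopologicalSpace B] [TopologicalSpace C] {q : A → B} {g : C → A} (hq : IsQuotientMap q)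
    (hg : IsOpenEmbedding g) (h : ∀ c a, q a = q (g c) → a = g c) :
    IsOpenEmbedding (q ∘ g) := by
  refine .of_continuous_injective_isOpenMap (hq.continuous.comp hg.continuous)
    (fun c c' hc => hg.injective (h c' (g c) hc)) fun U hU => ?_
  rw [← hq.isOpen_preimage]
  convert hg.isOpenMap U hU using 1
  ext a
  constructor
  · rintro ⟨c, hc, hca⟩
    exact ⟨c, hc, (h c a hca.symm).symm⟩
  · rintro ⟨c, hc, rfl⟩
    exact ⟨c, hc, rfl⟩

namespace MappingTorus

variable {X Y : Type*} [TopologicalSpace X] [TopologicalSpace Y]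

/-- Conjugate homeomorphisms have homeomorphic mapping tori. -/
def conj (e : X ≃ₜ Y) {f : X → X} {g : Y → Y} (h : ∀ x, e (f x) = g (e x)) :
    MappingTorus f ≃ₜ MappingTorus g :=
  Homeomorph.Quot.congr (e.prodCongr (Homeomorph.refl _)) fun p q => by simp [← h]

/-- Composing the monodromy with the end of an isotopy that starts at the identity does not
change the mapping torus. The map `Q t` is the inverse of the stage `P t` of the isotopy. -/
def isotopy (P Q : unitInterval → X → X)
    (hP : Continuous fun p : X × unitInterval => P p.2 p.1)
    (hQ : Continuous fun p : X × unitInterval => Q p.2 p.1)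
    (hPQ : ∀ t, Function.LeftInverse (P t) (Q t)) (hQP : ∀ t, Function.LeftInverse (Q t) (P t))
    (h0 : ∀ x, P 0 x = x) (f : X → X) :
    MappingTorus f ≃ₜ MappingTorus (P 1 ∘ f) :=
  Homeomorph.Quot.congr
    { toFun := fun p => (P p.2 p.1, p.2)
      invFun := fun p => (Q p.2 p.1, p.2)
      left_inv := fun p => by simp [(hQP p.2).eq]
      right_inv := fun p => by simp [(hPQ p.2).eq]
      continuous_toFun := hP.prodMk continuous_snd
      continuous_invFun := hQ.prodMk continuous_snd }
    fun p q => by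
      rcases p with ⟨x, s⟩
      rcases q with ⟨y, t⟩
      constructor
      · rintro ⟨rfl, rfl, rfl⟩
        exact ⟨rfl, rfl, by simp [h0]⟩
      · rintro ⟨rfl : s = 0, rfl : t = 1, h : P 1 y = P 1 (f (P 0 x))⟩
        exact ⟨rfl, rfl, (hQP 1).injective (by rw [h, h0])⟩

theorem nonempty_homeomorph [CompactSpace X] [T2Space Y] {φ : X → X} {f : X × unitInterval → Y}
    (hf : Continuous f) (hsurj : Function.Surjective f) (h01 : ∀ x, f (x, 0) = f (φ x, 1))
    (hinj : ∀ p q : X × unitInterval, p.2 ≤ q.2 → f p = f q →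
      p = q ∨ (p.2 = 0 ∧ q.2 = 1 ∧ q.1 = φ p.1)) :
    Nonempty (MappingTorus φ ≃ₜ Y) := by
  let F : MappingTorus φ → Y := Quot.lift f <| by
    rintro ⟨x, _⟩ ⟨_, _⟩ ⟨rfl, rfl, rfl⟩
    exact h01 x
  have mk_eq_mk : ∀ p q : X × unitInterval, p.2 ≤ q.2 → f p = f q →
      (Quot.mk _ p : MappingTorus φ) = Quot.mk _ q := fun p q hpq h =>
    (hinj p q hpq h).elim (congrArg _) (Quot.sound ·)
  have hF : Function.Bijective F := by
    refine ⟨?_, fun y => ?_⟩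
    · rintro ⟨p⟩ ⟨q⟩ h
      rcases le_total p.2 q.2 with hpq | hpq
      · exact mk_eq_mk p q hpq h
      · exact (mk_eq_mk q p hpq h.symm).symm
    · obtain ⟨p, rfl⟩ := hsurj y
      exact ⟨Quot.mk _ p, rfl⟩
  exact ⟨Continuous.homeoOfEquivCompactToT2 (f := Equiv.ofBijective F hF)
    (continuous_quot_lift _ hf)⟩

theorem circleExp_two_pi_mul_eq_iff {s t : unitInterval} (hst : s ≤ t) :
    Circle.exp (2 * Real.pi * s) = Circle.exp (2 * Real.pi * t) ↔ s = t ∨ s = 0 ∧ t = 1 := by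
  constructor
  · intro h
    obtain ⟨m, hm⟩ := Circle.exp_eq_exp.mp h
    have hst' : (s : ℝ) = t + m := by
      have hpi : 2 * Real.pi ≠ 0 := Real.two_pi_pos.ne'
      exact mul_left_cancel₀ hpi (by linarith)
    have hm0 : m ≤ 0 := by exact_mod_cast show (m : ℝ) ≤ 0 by linarith [Subtype.coe_le_coe.mpr hst]
    have hm1 : -1 ≤ m := by exact_mod_cast show (-1 : ℝ) ≤ m by linarith [s.2.1, t.2.2]
    obtain rfl | rfl : m = 0 ∨ m = -1 := by omega
    · exact Or.inl (Subtype.ext (by simpa using hst'))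
    · rw [Int.cast_neg, Int.cast_one] at hst'
      exact Or.inr ⟨Subtype.ext (le_antisymm (by simp; linarith [t.2.2]) s.2.1),
        Subtype.ext (le_antisymm t.2.2 (by simp; linarith [s.2.1]))⟩
  · rintro (rfl | ⟨rfl, rfl⟩)
    · rfl
    · simp

theorem nonempty_homeomorph_prod_circle [CompactSpace X] [T2Space X] :
    Nonempty (MappingTorus (id : X → X) ≃ₜ X × Circle) := by
  refine nonempty_homeomorph (f := fun p => (p.1, Circle.exp (2 * Real.pi * p.2)))
    (by fun_prop) ?_ (by simp) ?_
  · rintro ⟨x, z⟩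
    refine ⟨(x, ⟨Int.fract (z.1.arg / (2 * Real.pi)), Int.fract_nonneg _,
      (Int.fract_lt_one _).le⟩), Prod.ext rfl ?_⟩
    refine Eq.trans (Circle.exp_eq_exp.mpr ⟨-⌊z.1.arg / (2 * Real.pi)⌋, ?_⟩) (Circle.exp_arg z)
    simp only [Int.fract]
    push_cast
    field_simp
    ring
  · rintro ⟨x, s⟩ ⟨y, t⟩ hst h
    obtain ⟨rfl, h⟩ := Prod.mk.inj h
    simpa using (circleExp_two_pi_mul_eq_iff hst).mp h

omit [TopologicalSpace X] in
theorem eq_of_mk_eq_mk {φ : X → X} {p q : X × unitInterval} (hp : p.2 ∈ Set.Ioo 0 1)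
    (h : (Quot.mk _ q : MappingTorus φ) = Quot.mk _ p) : q = p := by
  let eqP : MappingTorus φ → Prop := Quot.lift (· = p) <| by
    rintro a b ⟨ha, hb, -⟩
    have ha' : a ≠ p := fun e => hp.1.ne' (e ▸ ha)
    have hb' : b ≠ p := fun e => hp.2.ne (e ▸ hb)
    simp only [ha', hb']
  exact (congrArg eqP h).mpr rfl

theorem isOpenEmbedding_interior (φ : X → X) :
    IsOpenEmbedding fun p : X × Set.Ioo (0 : ℝ) 1 =>
      (Quot.mk _ (p.1, Set.inclusion Set.Ioo_subset_Icc_self p.2) : MappingTorus φ) := by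
  have hopen : IsOpenEmbedding (Set.inclusion (Set.Ioo_subset_Icc_self (a := (0 : ℝ)) (b := 1))) :=
    ⟨.inclusion _, by
      rw [Set.range_inclusion]
      exact isOpen_Ioo.preimage continuous_subtype_val⟩
  exact isOpenEmbedding_comp_of_isQuotientMap isQuotientMap_quot_mk
    (IsOpenEmbedding.id.prodMap hopen) fun c _ => eq_of_mk_eq_mk c.2.2

/-- Translation of the base circle by half a turn. -/
noncomputable def halfTurn (φ : X ≃ₜ X) : MappingTorus φ → MappingTorus φ :=
  Quot.lift
    (fun p => if (p.2 : ℝ) ≤ 1 / 2 then Quot.mk _ (p.1, Set.projIcc 0 1 zero_le_one (p.2 + 1 / 2))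
      else Quot.mk _ (φ.symm p.1, Set.projIcc 0 1 zero_le_one (p.2 - 1 / 2))) <| by
    rintro ⟨x, _⟩ ⟨_, _⟩ ⟨rfl, rfl, rfl⟩
    norm_num

theorem continuous_halfTurn (φ : X ≃ₜ X) : Continuous (halfTurn φ) := by
  refine continuous_quot_lift _ (Continuous.if_le ?_ ?_ (by fun_prop) (by fun_prop) ?_)
  · exact continuous_quot_mk.comp (by fun_prop)
  · exact continuous_quot_mk.comp (by fun_prop)
  · rintro ⟨x, t⟩ (ht : (t : ℝ) = 1 / 2)
    have h1 : Set.projIcc (0 : ℝ) 1 zero_le_one (t + 1 / 2) = 1 :=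
      Set.projIcc_of_right_le _ (by rw [ht]; norm_num)
    have h0 : Set.projIcc (0 : ℝ) 1 zero_le_one (t - 1 / 2) = 0 :=
      Set.projIcc_of_le_left _ (by rw [ht]; norm_num)
    exact (Quot.sound ⟨h0, h1, (φ.apply_symm_apply x).symm⟩).symm

theorem halfTurn_mk_of_eq_add (φ : X ≃ₜ X) (x : X) {s t : unitInterval}
    (hs : (s : ℝ) = t + 1 / 2) :
    halfTurn φ (Quot.mk _ (x, t)) = Quot.mk _ (x, s) := by
  have ht : (t : ℝ) ≤ 1 / 2 := by linarith [s.2.2]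
  exact (if_pos ht).trans (by rw [← hs, Set.projIcc_val])

theorem halfTurn_mk_of_eq_sub (φ : X ≃ₜ X) (x : X) {s t : unitInterval}
    (hs : (s : ℝ) = t - 1 / 2) :
    halfTurn φ (Quot.mk _ (x, t)) = Quot.mk _ (φ.symm x, s) := by
  rcases s.2.1.eq_or_lt with h0 | hpos
  · obtain rfl : s = 0 := Subtype.ext h0.symm
    rw [halfTurn_mk_of_eq_add φ x (s := 1) (by simp at hs ⊢; linarith)]
    exact (Quot.sound ⟨rfl, rfl, (φ.apply_symm_apply x).symm⟩).symm
  · have ht : ¬(t : ℝ) ≤ 1 / 2 := by linarith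
    exact (if_neg ht).trans (by rw [← hs, Set.projIcc_val])

theorem halfTurn_halfTurn (φ : X ≃ₜ X) (z : MappingTorus φ) :
    halfTurn φ (halfTurn φ z) = conj φ.symm (g := φ) (by simp) z := by
  obtain ⟨x, t⟩ := z
  change _ = Quot.mk _ (φ.symm x, t)
  rcases le_total (t : ℝ) (1 / 2) with ht | ht
  · let s : unitInterval := ⟨t + 1 / 2, by linarith [t.2.1], by linarith⟩
    rw [halfTurn_mk_of_eq_add φ x (s := s) rfl,
      halfTurn_mk_of_eq_sub φ x (by simp only [s]; ring)]
  · let s : unitInterval := ⟨t - 1 / 2, by linarith, by linarith [t.2.2]⟩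
    rw [halfTurn_mk_of_eq_sub φ x (s := s) rfl,
      halfTurn_mk_of_eq_add φ _ (by simp only [s]; ring)]

theorem isHomeomorph_halfTurn (φ : X ≃ₜ X) : IsHomeomorph (halfTurn φ) := by
  let T : MappingTorus φ ≃ₜ MappingTorus φ := conj φ.symm (by simp)
  have hT : ∀ z, halfTurn φ (halfTurn φ z) = T z := halfTurn_halfTurn φ
  refine isHomeomorph_iff_exists_inverse.mpr ⟨continuous_halfTurn φ, halfTurn φ ∘ T.symm, ?_, ?_,
    (continuous_halfTurn φ).comp T.symm.continuous⟩
  · intro z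
    have hcomm : T (halfTurn φ (T.symm (halfTurn φ z))) = T z := by
      rw [← hT, hT (T.symm _), T.apply_symm_apply, hT]
    exact T.injective hcomm
  · intro z
    simp [hT]

end MappingTorus

theorem IsLocallyEuclidean.mappingTorus {n : ℕ} {X : Type*} [TopologicalSpace X]
    (hX : IsLocallyEuclidean n X) (φ : X ≃ₜ X) :
    IsLocallyEuclidean (n + 1) (MappingTorus φ) := by
  have hcyl : IsLocallyEuclidean (n + 1) (X × Set.Ioo (0 : ℝ) 1) :=
    hX.prod_real.of_isOpenEmbedding
      (IsOpenEmbedding.id.prodMap isOpen_Ioo.isOpenEmbedding_subtypeVal)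
  have hint := MappingTorus.isOpenEmbedding_interior φ
  have hseam := (MappingTorus.isHomeomorph_halfTurn φ).isOpenEmbedding.comp hint
  let half : Set.Ioo (0 : ℝ) 1 := ⟨1 / 2, by norm_num, by norm_num⟩
  let mid : unitInterval := Set.inclusion Set.Ioo_subset_Icc_self half
  rintro ⟨x, t⟩
  rcases eq_or_ne t 0 with rfl | ht0
  · have hx : MappingTorus.halfTurn φ (Quot.mk _ (φ x, mid)) = Quot.mk _ (x, 0) := by
      rw [MappingTorus.halfTurn_mk_of_eq_sub φ _ (s := 0) (by simp [mid, half]), φ.symm_apply_apply]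
    exact hx ▸ hcyl.exists_chart hseam (φ x, half)
  rcases eq_or_ne t 1 with rfl | ht1
  · have hx : MappingTorus.halfTurn φ (Quot.mk _ (x, mid)) = Quot.mk _ (x, 1) :=
      MappingTorus.halfTurn_mk_of_eq_add φ x (by norm_num [mid, half])
    exact hx ▸ hcyl.exists_chart hseam (x, half)
  · exact hcyl.exists_chart hint
      (x, ⟨t, unitInterval.pos_iff_ne_zero.mpr ht0, unitInterval.lt_one_iff_ne_one.mpr ht1⟩)

section Bistellar

variable {V : Type*} [DecidableEq V] {K : Set (Finset V)} {A B : Finset V} {b : V}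

/-- The bistellar move that replaces the faces of `K` containing `A` by new faces containing
`B`. -/
def bistellar (K : Set (Finset V)) (A B : Finset V) : Set (Finset V) :=
  {s | ¬A ⊆ s ∧ (s ∈ K ∨ B ⊆ s ∧ s \ B ∪ A ∈ K)}

/-- The situation in which a bistellar move may replace `A` by `B`: the nonempty set `B` is a
missing face disjoint from `A`, and the star of `A` contains its own join with the boundary of
`B`. -/
structure IsFlippable (K : Set (Finset V)) (A B : Finset V) : Prop where
  nonempty_left : A.Nonempty
  nonempty_right : B.Nonempty
  disjoint : Disjoint A B
  notMem : B ∉ K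
  union_mem : ∀ s ∈ K, A ⊆ s → Disjoint s B → ∀ b ∈ B, s ∪ B.erase b ∈ K

theorem isFlippable_singleton (hA : A.Nonempty) (hbA : b ∉ A) (hbK : {b} ∉ K) :
    IsFlippable K A {b} where
  nonempty_left := hA
  nonempty_right := Finset.singleton_nonempty b
  disjoint := Finset.disjoint_singleton_right.mpr hbA
  notMem := hbK
  union_mem s hs _ _ b' hb' := by simpa [Finset.mem_singleton.mp hb'] using hs

theorem IsFlippable.not_subset (h : IsFlippable K A B) (hK : IsLowerSet K) {s : Finset V}
    (hs : s ∈ K) : ¬B ⊆ s :=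
  fun hBs => h.notMem (hK hBs hs)

theorem IsFlippable.subset_mem (h : IsFlippable K A B) (hK : IsLowerSet K) {s t : Finset V}
    (hs : s \ B ∪ A ∈ K) (hb : b ∈ B) (ht : t ⊆ (s \ B ∪ A) ∪ B.erase b) : t ∈ K :=
  hK ht (h.union_mem _ hs Finset.subset_union_right
    (Finset.disjoint_union_left.mpr ⟨Finset.sdiff_disjoint, h.disjoint⟩) b hb)

theorem IsFlippable.isLowerSet_bistellar (h : IsFlippable K A B) (hK : IsLowerSet K) :
    IsLowerSet (bistellar K A B) := by
  rintro s t (hts : t ⊆ s) ⟨hA, hs⟩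
  refine ⟨fun hAt => hA (hAt.trans hts), ?_⟩
  rcases hs with hs | ⟨-, hs⟩
  · exact Or.inl (hK hts hs)
  by_cases hBt : B ⊆ t
  · exact Or.inr ⟨hBt, hK (Finset.union_subset_union (Finset.sdiff_subset_sdiff hts subset_rfl)
      subset_rfl) hs⟩
  · obtain ⟨b, hb, hbt⟩ := Finset.not_subset.mp hBt
    exact Or.inl (h.subset_mem hK hs hb (by grind))

/-- One direction of the relation between two complexes that differ by a bistellar move replacing
`A` by `B`. The relation is symmetric: the move is invertible when `IsBistellarHalf K L A B` and
`IsBistellarHalf L K B A`. -/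
structure IsBistellarHalf (K L : Set (Finset V)) (A B : Finset V) : Prop where
  not_subset : ∀ s ∈ K, ¬B ⊆ s
  mem : ∀ s ∈ K, ¬A ⊆ s → s ∈ L
  exchange : ∀ s ∈ K, A ⊆ s → ∀ a ∈ A, s.erase a ∪ B ∈ L

theorem IsFlippable.isBistellarHalf (h : IsFlippable K A B) (hK : IsLowerSet K) :
    IsBistellarHalf K (bistellar K A B) A B where
  not_subset _ hs := h.not_subset hK hs
  mem _ hs hAs := ⟨hAs, Or.inl hs⟩
  exchange s hs hAs a ha := by
    have haB : a ∉ B := Finset.disjoint_left.mp h.disjoint ha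
    exact ⟨fun hA => by simpa [haB] using hA ha,
      Or.inr ⟨Finset.subset_union_right, hK (by grind) hs⟩⟩

theorem IsFlippable.isBistellarHalf_symm (h : IsFlippable K A B) (hK : IsLowerSet K) :
    IsBistellarHalf (bistellar K A B) K B A where
  not_subset _ hs := hs.1
  mem _ hs hBs := hs.2.resolve_right fun h => hBs h.1
  exchange s hs hBs b hb := by
    obtain hsK | ⟨-, hsK⟩ := hs.2
    · exact absurd hBs (h.not_subset hK hsK)
    · exact h.subset_mem hK hsK hb (by grind)

/-- The stellar subdivision of `K` at the face `A` with new vertex `b`. -/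
abbrev stellar (K : Set (Finset V)) (A : Finset V) (b : V) : Set (Finset V) :=
  bistellar K A {b}

end Bistellar

section Polyhedron

variable {V : Type*} [Fintype V]

/-- The points of the standard simplex supported on a member of the family `K`: the geometric
realization, for families that need not be bundled as complexes and may contain `∅`. -/
def polyhedron (K : Set (Finset V)) : Set (V → ℝ) :=
  {x | x ∈ stdSimplex ℝ V ∧ ∃ s ∈ K, ∀ v, v ∉ s → x v = 0}

variable [DecidableEq V] {K L : Set (Finset V)} {A B : Finset V}

/-- The map underlying a bistellar move: the largest multiple of the barycentre of `A` below `x`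
is moved to the barycentre of `B`. -/
noncomputable def moveMass (A B : Finset V) (hA : A.Nonempty) (x : V → ℝ) (v : V) : ℝ :=
  x v - (if v ∈ A then A.inf' hA x else 0) +
    (if v ∈ B then (A.card / B.card : ℝ) * A.inf' hA x else 0)

omit [Fintype V] in
theorem continuous_moveMass (A B : Finset V) (hA : A.Nonempty) :
    Continuous (moveMass A B hA) := by
  have : Continuous fun x : V → ℝ => A.inf' hA x :=
    Continuous.finset_inf'_apply hA fun i _ => continuous_apply i
  refine continuous_pi fun v => ?_
  unfold moveMass
  split_ifs <;> fun_prop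

theorem moveMass_mem_stdSimplex (hA : A.Nonempty) (hB : B.Nonempty) {x : V → ℝ}
    (hx : x ∈ stdSimplex ℝ V) : moveMass A B hA x ∈ stdSimplex ℝ V := by
  obtain ⟨h0, h1⟩ := hx
  have hB0 : (B.card : ℝ) ≠ 0 := by exact_mod_cast hB.card_ne_zero
  refine ⟨fun v => ?_, ?_⟩
  · have hm : 0 ≤ A.inf' hA x := (Finset.le_inf'_iff _ _).mpr fun a _ => h0 a
    have hA' : 0 ≤ x v - if v ∈ A then A.inf' hA x else 0 := by
      split_ifs with hv
      · exact sub_nonneg.mpr (Finset.inf'_le _ hv)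
      · simpa using h0 v
    exact add_nonneg hA' (by positivity)
  · simp only [moveMass, Finset.sum_add_distrib, Finset.sum_sub_distrib, h1, Finset.sum_ite_mem,
      Finset.univ_inter, Finset.sum_const, nsmul_eq_mul]
    field_simp
    ring

theorem IsBistellarHalf.moveMass_mem (h : IsBistellarHalf K L A B) (hA : A.Nonempty)
    (hB : B.Nonempty) {x : V → ℝ} (hx : x ∈ polyhedron K) :
    moveMass A B hA x ∈ polyhedron L := by
  obtain ⟨hx, s, hs, hsx⟩ := hx
  refine ⟨moveMass_mem_stdSimplex hA hB hx, ?_⟩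
  by_cases hAs : A ⊆ s
  · obtain ⟨a, ha, hax⟩ := Finset.exists_mem_eq_inf' hA x
    refine ⟨_, h.exchange s hs hAs a ha, fun v hv => ?_⟩
    simp only [Finset.mem_union, Finset.mem_erase, not_or, not_and] at hv
    rcases eq_or_ne v a with rfl | hva
    · simp [moveMass, ha, hax, hv.2]
    · have hvs := hv.1 hva
      simp [moveMass, hv.2, hsx v hvs, mt (@hAs v) hvs]
  · obtain ⟨a, ha, has⟩ := Finset.not_subset.mp hAs
    have hm : A.inf' hA x = 0 := le_antisymm (hsx a has ▸ Finset.inf'_le _ ha)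
      ((Finset.le_inf'_iff _ _).mpr fun a _ => hx.1 a)
    exact ⟨s, h.mem s hs hAs, fun v hv => by simp [moveMass, hm, hsx v hv]⟩

theorem IsBistellarHalf.moveMass_moveMass (h : IsBistellarHalf K L A B) (hAB : Disjoint A B)
    (hA : A.Nonempty) (hB : B.Nonempty) {x : V → ℝ} (hx : x ∈ polyhedron K) :
    moveMass B A hB (moveMass A B hA x) = x := by
  obtain ⟨⟨h0, -⟩, s, hs, hsx⟩ := hx
  have hA0 : (A.card : ℝ) ≠ 0 := by exact_mod_cast hA.card_ne_zero
  have hB0 : (B.card : ℝ) ≠ 0 := by exact_mod_cast hB.card_ne_zero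
  obtain ⟨b, hb, hbs⟩ := Finset.not_subset.mp (h.not_subset s hs)
  have hval : ∀ v ∈ B, moveMass A B hA x v = x v + (A.card / B.card : ℝ) * A.inf' hA x :=
    fun v hv => by simp [moveMass, hv, Finset.disjoint_right.mp hAB hv]
  have hinf : B.inf' hB (moveMass A B hA x) = (A.card / B.card : ℝ) * A.inf' hA x := by
    refine le_antisymm ((Finset.inf'_le _ hb).trans ?_)
      ((Finset.le_inf'_iff _ _).mpr fun v hv => ?_)
    · rw [hval b hb, hsx b hbs, zero_add]
    · rw [hval v hv]
      linarith [h0 v]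
  have hcancel : (B.card / A.card : ℝ) * ((A.card / B.card : ℝ) * A.inf' hA x) = A.inf' hA x := by
    field_simp
  funext v
  rw [moveMass, hinf, hcancel, moveMass]
  ring

theorem IsFlippable.nonempty_homeomorph (h : IsFlippable K A B) (hK : IsLowerSet K) :
    Nonempty (polyhedron K ≃ₜ polyhedron (bistellar K A B)) := by
  have hA := h.nonempty_left
  have hB := h.nonempty_right
  have hAB := h.disjoint
  have hto := h.isBistellarHalf hK
  have hinv := h.isBistellarHalf_symm hK
  exact ⟨{
    toFun := fun x => ⟨moveMass A B hA x, hto.moveMass_mem hA hB x.2⟩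
    invFun := fun x => ⟨moveMass B A hB x, hinv.moveMass_mem hB hA x.2⟩
    left_inv := fun x => Subtype.ext (hto.moveMass_moveMass hAB hA hB x.2)
    right_inv := fun x => Subtype.ext (hinv.moveMass_moveMass hAB.symm hB hA x.2)
    continuous_toFun := ((continuous_moveMass A B hA).comp continuous_subtype_val).subtype_mk _
    continuous_invFun := ((continuous_moveMass B A hB).comp continuous_subtype_val).subtype_mk _ }⟩

end Polyhedron

section MapFaces

variable {V W : Type*} {K : Set (Finset V)}

/-- The copy of the complex `K` on the vertices `f v`, which need not exhaust the type `W`. -/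
def mapFaces (f : V ↪ W) (K : Set (Finset V)) : Set (Finset W) :=
  Finset.map f '' K

theorem isLowerSet_mapFaces (f : V ↪ W) (hK : IsLowerSet K) : IsLowerSet (mapFaces f K) := by
  rintro _ t (ht : t ⊆ _) ⟨s, hs, rfl⟩
  obtain ⟨u, hu, rfl⟩ := Finset.subset_map_iff.mp ht
  exact ⟨u, hK hu hs, rfl⟩

theorem singleton_mem_mapFaces {f : V ↪ W} {v : V} (hv : {v} ∈ K) : {f v} ∈ mapFaces f K :=
  ⟨_, hv, Finset.map_singleton f v⟩

theorem singleton_notMem_mapFaces {f : V ↪ W} {w : W} (hw : ∀ v, f v ≠ w) :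
    {w} ∉ mapFaces f K := by
  rintro ⟨s, -, hs⟩
  obtain ⟨v, -, hv⟩ := Finset.mem_map.mp (hs ▸ Finset.mem_singleton_self w)
  exact hw v hv

variable [Fintype W]

theorem eq_zero_of_mem_polyhedron_mapFaces {f : V ↪ W} {y : W → ℝ}
    (hy : y ∈ polyhedron (mapFaces f K)) {w : W} (hw : w ∉ Set.range f) : y w = 0 := by
  obtain ⟨-, _, ⟨s, -, rfl⟩, hsy⟩ := hy
  refine hsy w fun h => hw ?_
  obtain ⟨v, -, rfl⟩ := Finset.mem_map.mp h
  exact ⟨v, rfl⟩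

theorem extend_comp_eq {f : V ↪ W} {y : W → ℝ} (hy : y ∈ polyhedron (mapFaces f K)) :
    Function.extend f (y ∘ f) 0 = y := by
  funext w
  by_cases hw : w ∈ Set.range f
  · obtain ⟨v, rfl⟩ := hw
    exact f.injective.extend_apply _ _ v
  · rw [Function.extend_apply' _ _ _ hw, eq_zero_of_mem_polyhedron_mapFaces hy hw, Pi.zero_apply]

variable [Fintype V]

theorem comp_mem_polyhedron {f : V ↪ W} {y : W → ℝ} (hy : y ∈ polyhedron (mapFaces f K)) :
    y ∘ f ∈ polyhedron K := by
  have hy0 := fun w => eq_zero_of_mem_polyhedron_mapFaces hy (w := w)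
  obtain ⟨⟨h0, h1⟩, _, ⟨s, hs, rfl⟩, hsy⟩ := hy
  exact ⟨⟨fun v => h0 _, (Fintype.sum_of_injective f f.injective _ y hy0 fun _ => rfl).trans h1⟩,
    s, hs, fun v hv => hsy _ (by simpa using hv)⟩

theorem extend_mem_polyhedron (f : V ↪ W) {x : V → ℝ} (hx : x ∈ polyhedron K) :
    Function.extend f x 0 ∈ polyhedron (mapFaces f K) := by
  obtain ⟨⟨h0, h1⟩, s, hs, hsx⟩ := hx
  have hout : ∀ w ∉ Set.range f, Function.extend f x 0 w = 0 := fun w hw =>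
    Function.extend_apply' _ _ _ hw
  have hin : ∀ v, Function.extend f x 0 (f v) = x v := f.injective.extend_apply x 0
  refine ⟨⟨fun w => ?_, ?_⟩, s.map f, ⟨s, hs, rfl⟩, fun w hw => ?_⟩
  · by_cases hw : w ∈ Set.range f
    · obtain ⟨v, rfl⟩ := hw
      exact (h0 v).trans_eq (hin v).symm
    · exact (hout w hw).ge
  · exact (Fintype.sum_of_injective f f.injective x _ hout fun v => (hin v).symm).symm.trans h1
  · by_cases hw' : w ∈ Set.range f
    · obtain ⟨v, rfl⟩ := hw'
      exact (hin v).trans (hsx v (by simpa using hw))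
    · exact hout w hw'

theorem nonempty_homeomorph_mapFaces (f : V ↪ W) (K : Set (Finset V)) :
    Nonempty (polyhedron K ≃ₜ polyhedron (mapFaces f K)) := by
  have hext : Continuous fun x : V → ℝ => Function.extend f x 0 :=
    (Function.ExtendByZero.linearMap ℝ f).continuous_of_finiteDimensional
  have hcomp : Continuous fun y : W → ℝ => y ∘ f := by fun_prop
  exact ⟨{
    toFun := fun x => ⟨Function.extend f x.1 0, extend_mem_polyhedron f x.2⟩
    invFun := fun y => ⟨y.1 ∘ f, comp_mem_polyhedron y.2⟩
    left_inv := fun x => Subtype.ext (funext (f.injective.extend_apply x.1 0))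
    right_inv := fun y => Subtype.ext (extend_comp_eq y.2)
    continuous_toFun := (hext.comp continuous_subtype_val).subtype_mk _
    continuous_invFun := (hcomp.comp continuous_subtype_val).subtype_mk _ }⟩

end MapFaces

section CubeSphere

variable {d : ℕ}

/-- The boundary of the unit cube with the stars of two opposite corners removed: a model of the
sphere of dimension `d - 2`. -/
def cubeSphere (d : ℕ) : Set (Fin d → ℝ) :=
  {w | (∀ i, 0 ≤ w i) ∧ (∀ i, w i ≤ 1) ∧ (∃ i, w i = 0) ∧ ∃ i, w i = 1}

theorem one_sub_comp_mem_cubeSphere (σ : Equiv.Perm (Fin d)) {w : Fin d → ℝ}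
    (hw : w ∈ cubeSphere d) : (fun i => 1 - w (σ i)) ∈ cubeSphere d := by
  obtain ⟨h0, h1, ⟨i, hi⟩, ⟨j, hj⟩⟩ := hw
  exact ⟨fun k => sub_nonneg.mpr (h1 _), fun k => sub_le_self 1 (h0 _),
    ⟨σ.symm j, by simp [hj]⟩, ⟨σ.symm i, by simp [hi]⟩⟩

/-- The antipode in `cubeSphere`, followed by a permutation of the coordinates. -/
def cubeAntipode (σ : Equiv.Perm (Fin d)) (w : cubeSphere d) : cubeSphere d :=
  ⟨fun i => 1 - w.1 (σ i), one_sub_comp_mem_cubeSphere σ w.2⟩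

theorem exists_affine_mem_cubeSphere {v : Fin d → ℝ} (hv : ∃ i j, v i ≠ v j) :
    ∃ r > 0, ∃ k, (fun i => r * v i + k) ∈ cubeSphere d := by
  obtain ⟨i, j, hij⟩ := hv
  have : Nonempty (Fin d) := ⟨i⟩
  obtain ⟨a, ha⟩ := Finite.exists_min v
  obtain ⟨b, hb⟩ := Finite.exists_max v
  have hab : 0 < v b - v a := by
    by_contra! hba
    exact hij (by linarith [ha i, ha j, hb i, hb j])
  have heq : ∀ i, (v b - v a)⁻¹ * v i + -((v b - v a)⁻¹ * v a) = (v i - v a) / (v b - v a) :=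
    fun i => by ring
  refine ⟨(v b - v a)⁻¹, inv_pos.mpr hab, -((v b - v a)⁻¹ * v a), ?_⟩
  simp only [heq]
  exact ⟨fun i => div_nonneg (sub_nonneg.mpr (ha i)) hab.le,
    fun i => (div_le_one hab).mpr (sub_le_sub_right (hb i) _), ⟨a, by simp⟩, b, div_self hab.ne'⟩

theorem affine_eq_id_of_mem_cubeSphere {w w' : Fin d → ℝ} (hw : w ∈ cubeSphere d)
    (hw' : w' ∈ cubeSphere d) {r k : ℝ} (hr : 0 < r) (h : ∀ i, w i = r * w' i + k) :
    r = 1 ∧ k = 0 := by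
  obtain ⟨w_nonneg, w_le_one, ⟨i, hi⟩, ⟨j, hj⟩⟩ := hw
  obtain ⟨w'_nonneg, w'_le_one, ⟨i', hi'⟩, ⟨j', hj'⟩⟩ := hw'
  have hk : k = 0 := by
    apply le_antisymm
    · linarith [h i, mul_nonneg hr.le (w'_nonneg i)]
    · have := h i'
      rw [hi', mul_zero, zero_add] at this
      exact this ▸ w_nonneg i'
  subst hk
  refine ⟨le_antisymm ?_ ?_, rfl⟩
  · have := h j'
    rw [hj', mul_one, add_zero] at this
    exact this ▸ w_le_one j'
  · linarith [h j, mul_le_mul_of_nonneg_left (w'_le_one j) hr.le]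

end CubeSphere

section CrossTorus

variable {d : ℕ} {σ : Equiv.Perm (Fin d)} {c : Fin 3} {s t : Finset (Fin 3 × Fin d)}

/-- The identification of the labels of level `c` with those of level `c + 1`: only the last
cylinder is twisted. -/
def glue (σ : Equiv.Perm (Fin d)) (c : Fin 3) : Equiv.Perm (Fin d) :=
  if c = 2 then σ else Equiv.refl _

/-- The faces of the `c`-th cylinder: the boundary of the cross-polytope whose antipodal pairs are
`(c, i)` and `(c + 1, glue σ c i)`, without the two facets that form a whole level. -/
structure IsCylinderFace (σ : Equiv.Perm (Fin d)) (c : Fin 3) (s : Finset (Fin 3 × Fin d)) :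
    Prop where
  level : ∀ p ∈ s, p.1 = c ∨ p.1 = c + 1
  antipodal : ∀ i, (c, i) ∈ s → (c + 1, glue σ c i) ∉ s
  lower : ∃ i, (c, i) ∉ s
  upper : ∃ i, (c + 1, i) ∉ s

/-- Three cross-polytopal cylinders glued cyclically. -/
def crossTorus (σ : Equiv.Perm (Fin d)) : Set (Finset (Fin 3 × Fin d)) :=
  {s | ∃ c, IsCylinderFace σ c s}

theorem IsCylinderFace.mono (h : IsCylinderFace σ c s) (hts : t ⊆ s) : IsCylinderFace σ c t where
  level p hp := h.level p (hts hp)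
  antipodal i hi hi' := h.antipodal i (hts hi) (hts hi')
  lower := h.lower.imp fun _ hi hi' => hi (hts hi')
  upper := h.upper.imp fun _ hi hi' => hi (hts hi')

theorem isLowerSet_crossTorus (σ : Equiv.Perm (Fin d)) : IsLowerSet (crossTorus σ) :=
  fun _ _ hts ⟨c, h⟩ => ⟨c, h.mono hts⟩

/-- The point at height `θ` over `w` in the `c`-th cylinder, in unnormalised barycentric
coordinates. -/
noncomputable def cylinderPoint (σ : Equiv.Perm (Fin d)) (c : Fin 3) (w : Fin d → ℝ) (θ : ℝ)
    (p : Fin 3 × Fin d) : ℝ :=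
  if p.1 = c then (w p.2 - θ)⁺
  else if p.1 = c + 1 then (w ((glue σ c).symm p.2) - θ)⁻ else 0

theorem cylinderPoint_lower (w : Fin d → ℝ) (θ : ℝ) (i : Fin d) :
    cylinderPoint σ c w θ (c, i) = (w i - θ)⁺ := by
  simp [cylinderPoint]

theorem cylinderPoint_upper (w : Fin d → ℝ) (θ : ℝ) (i : Fin d) :
    cylinderPoint σ c w θ (c + 1, glue σ c i) = (w i - θ)⁻ := by
  simp [cylinderPoint]

theorem cylinderPoint_nonneg (w : Fin d → ℝ) (θ : ℝ) (p : Fin 3 × Fin d) :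
    0 ≤ cylinderPoint σ c w θ p := by
  unfold cylinderPoint
  split_ifs
  exacts [posPart_nonneg _, negPart_nonneg _, le_rfl]

theorem cylinderPoint_affine {r : ℝ} (hr : 0 ≤ r) (v : Fin d → ℝ) (k : ℝ) (p : Fin 3 × Fin d) :
    cylinderPoint σ c (fun i => r * v i + k) k p = r * cylinderPoint σ c v 0 p := by
  simp only [cylinderPoint, posPart_def, negPart_def, add_sub_cancel_right, sub_zero]
  split_ifs
  · rw [mul_max_of_nonneg _ _ hr, mul_zero]
  · rw [mul_max_of_nonneg _ _ hr, mul_zero, mul_neg]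
  · rw [mul_zero]

theorem exists_cylinderPoint_pos {w : Fin d → ℝ} (hw : w ∈ cubeSphere d) (θ : ℝ) :
    ∃ p, 0 < cylinderPoint σ c w θ p := by
  obtain ⟨-, -, ⟨i, hi⟩, ⟨j, hj⟩⟩ := hw
  rcases lt_or_ge θ 1 with h | h
  · exact ⟨(c, j), by rw [cylinderPoint_lower, hj, posPart_pos_iff]; linarith⟩
  · exact ⟨(c + 1, glue σ c i), by rw [cylinderPoint_upper, hi, negPart_pos_iff]; linarith⟩

theorem exists_isCylinderFace_cylinderPoint {w : Fin d → ℝ} (hw : w ∈ cubeSphere d) {θ : ℝ}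
    (hθ : θ ∈ Set.Icc 0 1) :
    ∃ s, IsCylinderFace σ c s ∧ ∀ p, p ∉ s → cylinderPoint σ c w θ p = 0 := by
  classical
  obtain ⟨-, -, ⟨i, hi⟩, ⟨j, hj⟩⟩ := hw
  refine ⟨Finset.univ.filter fun p => cylinderPoint σ c w θ p ≠ 0,
    ⟨fun p hp => ?_, fun k hk hk' => ?_, ⟨i, ?_⟩, ⟨glue σ c j, ?_⟩⟩,
    fun p hp => by simpa using hp⟩
  · by_contra! h
    exact (Finset.mem_filter.mp hp).2 (by simp [cylinderPoint, h.1, h.2])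
  · simp only [Finset.mem_filter, Finset.mem_univ, true_and, cylinderPoint_lower,
      cylinderPoint_upper, ne_eq, posPart_eq_zero, negPart_eq_zero, not_le] at hk hk'
    exact lt_asymm hk hk'
  · simp [cylinderPoint_lower, hi, hθ.1]
  · simp [cylinderPoint_upper, hj, hθ.2]

theorem cylinderPoint_injective {w w' : Fin d → ℝ} (hw : w ∈ cubeSphere d)
    (hw' : w' ∈ cubeSphere d) {θ θ' r : ℝ} (hr : 0 < r)
    (h : ∀ p, cylinderPoint σ c w θ p = r * cylinderPoint σ c w' θ' p) : w = w' ∧ θ = θ' := by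
  have haffine : ∀ i, w i = r * w' i + (θ - r * θ') := by
    intro i
    have hlower := h (c, i)
    have hupper := h (c + 1, glue σ c i)
    rw [cylinderPoint_lower, cylinderPoint_lower] at hlower
    rw [cylinderPoint_upper, cylinderPoint_upper] at hupper
    linear_combination hlower - hupper - posPart_sub_negPart (w i - θ) +
      r * posPart_sub_negPart (w' i - θ')
  obtain ⟨rfl, hθ⟩ := affine_eq_id_of_mem_cubeSphere hw hw' hr haffine
  exact ⟨funext fun i => by linarith [haffine i], by linarith⟩

theorem IsCylinderFace.cylinderPoint_eq (hs : IsCylinderFace σ c s) {x : Fin 3 × Fin d → ℝ}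
    (hx : ∀ p, 0 ≤ x p) (hsx : ∀ p, p ∉ s → x p = 0) :
    cylinderPoint σ c (fun i => x (c, i) - x (c + 1, glue σ c i)) 0 = x := by
  have hparts : ∀ i, (x (c, i) - x (c + 1, glue σ c i))⁺ = x (c, i) ∧
      (x (c, i) - x (c + 1, glue σ c i))⁻ = x (c + 1, glue σ c i) := by
    intro i
    by_cases h : (c, i) ∈ s
    · simp [hsx _ (hs.antipodal i h), hx]
    · simp [hsx _ h, hx]
  funext ⟨e, i⟩
  by_cases he : e = c
  · rw [he, cylinderPoint_lower, sub_zero, (hparts i).1]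
  by_cases he' : e = c + 1
  · obtain ⟨k, rfl⟩ := (glue σ c).surjective i
    rw [he', cylinderPoint_upper, sub_zero, (hparts k).2]
  · rw [hsx _ fun h => (hs.level _ h).elim he he']
    simp [cylinderPoint, he, he']

theorem IsCylinderFace.exists_cylinderPoint_eq (hs : IsCylinderFace σ c s)
    {x : Fin 3 × Fin d → ℝ} (hx : ∀ p, 0 ≤ x p) (hx0 : x ≠ 0) (hsx : ∀ p, p ∉ s → x p = 0) :
    ∃ w ∈ cubeSphere d, ∃ θ ∈ Set.Icc (0 : ℝ) 1, ∃ r > 0,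
      ∀ p, cylinderPoint σ c w θ p = r * x p := by
  let v : Fin d → ℝ := fun i => x (c, i) - x (c + 1, glue σ c i)
  have hvx : cylinderPoint σ c v 0 = x := hs.cylinderPoint_eq hx hsx
  obtain ⟨a, ha⟩ : ∃ a, v a ≤ 0 := hs.lower.imp fun a ha => by simp [v, hsx _ ha, hx]
  obtain ⟨b, hb⟩ : ∃ b, 0 ≤ v b := by
    obtain ⟨j, hj⟩ := hs.upper
    exact ⟨(glue σ c).symm j, by simp [v, hsx _ hj, hx]⟩
  have hv : ∃ i j, v i ≠ v j := by
    by_contra! hconst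
    have hzero : v = 0 := funext fun i =>
      le_antisymm (hconst i a ▸ ha) (hconst i b ▸ hb)
    exact hx0 (by rw [← hvx, hzero]; funext p; simp [cylinderPoint])
  obtain ⟨r, hr, k, hw⟩ := exists_affine_mem_cubeSphere hv
  refine ⟨_, hw, k, ⟨?_, ?_⟩, r, hr, fun p => by rw [cylinderPoint_affine hr.le, hvx]⟩
  · linarith [hw.1 a, mul_nonpos_of_nonneg_of_nonpos hr.le ha]
  · linarith [hw.2.1 b, mul_nonneg hr.le hb]

/-- The winding of `cubeSphere d × [0, 3]` around the three cylinders. -/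
noncomputable def winding (σ : Equiv.Perm (Fin d)) (w : Fin d → ℝ) (T : ℝ)
    (p : Fin 3 × Fin d) : ℝ :=
  if p.1 = 0 then (w p.2 - T)⁺ + (T - 2 - w (σ.symm p.2))⁺
  else if p.1 = 1 then (1 - w p.2 - |T - 1|)⁺
  else (w p.2 - |T - 2|)⁺

theorem continuous_winding (σ : Equiv.Perm (Fin d)) (p : Fin 3 × Fin d) :
    Continuous fun q : (Fin d → ℝ) × ℝ => winding σ q.1 q.2 p := by
  simp only [winding, posPart_def]
  split_ifs <;> fun_prop

/-- The point of the `c`-th cylinder met by the winding path of `w`: on the odd cylinder the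
heights of the points of `cubeSphere` are reversed. -/
def unwind (c : Fin 3) (w : Fin d → ℝ) : Fin d → ℝ :=
  if c = 1 then fun i => 1 - w i else w

theorem unwind_mem_cubeSphere {w : Fin d → ℝ} (hw : w ∈ cubeSphere d) :
    unwind c w ∈ cubeSphere d := by
  unfold unwind
  split_ifs
  exacts [one_sub_comp_mem_cubeSphere 1 hw, hw]

theorem unwind_involutive (c : Fin 3) : Function.Involutive (unwind (d := d) c) := by
  intro w
  unfold unwind
  split_ifs <;> simp

theorem winding_add {w : Fin d → ℝ} (hw : w ∈ cubeSphere d) (c : Fin 3) {θ : ℝ}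
    (hθ : θ ∈ Set.Icc 0 1) : winding σ w (c.val + θ) = cylinderPoint σ c (unwind c w) θ := by
  obtain ⟨h0, h1⟩ := hθ
  funext ⟨e, i⟩
  have := hw.1 i
  have := hw.2.1 i
  have := hw.1 (σ.symm i)
  fin_cases c <;> fin_cases e <;>
    simp [winding, cylinderPoint, unwind, glue, posPart_def, negPart_def] <;> grind

theorem exists_eq_add {T : ℝ} (hT : T ∈ Set.Icc 0 3) :
    ∃ c : Fin 3, ∃ θ ∈ Set.Icc (0 : ℝ) 1, T = c.val + θ := by
  obtain ⟨h0, h3⟩ := hT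
  rcases le_total T 1 with h | h
  · exact ⟨0, T, ⟨h0, h⟩, by simp⟩
  rcases le_total T 2 with h' | h'
  · exact ⟨1, T - 1, ⟨by linarith, by linarith⟩, by simp⟩
  · exact ⟨2, T - 2, ⟨by linarith, by linarith⟩, by simp⟩

theorem winding_one_eq_zero_iff {w : Fin d → ℝ} (hw : w ∈ cubeSphere d) (T : ℝ) :
    (∀ i, winding σ w T (1, i) = 0) ↔ 1 ≤ |T - 1| := by
  simp only [winding, one_ne_zero, if_false, if_true, posPart_eq_zero]
  obtain ⟨h0, -, ⟨i, hi⟩, -⟩ := hw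
  exact ⟨fun h => by linarith [h i], fun h i => by linarith [h0 i]⟩

theorem winding_two_eq_zero_iff {w : Fin d → ℝ} (hw : w ∈ cubeSphere d) (T : ℝ) :
    (∀ i, winding σ w T (2, i) = 0) ↔ 1 ≤ |T - 2| := by
  simp only [winding, Fin.reduceEq, if_false, posPart_eq_zero]
  obtain ⟨-, h1, -, ⟨i, hi⟩⟩ := hw
  exact ⟨fun h => by linarith [h i], fun h i => by linarith [h1 i]⟩

theorem winding_zero_eq_winding_three (w : cubeSphere d) :
    winding σ w 0 = winding σ (cubeAntipode σ w) 3 := by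
  funext ⟨e, i⟩
  have := w.2.1 i
  have := w.2.2.1 i
  have := w.2.1 (σ i)
  have := w.2.2.1 (σ i)
  have := w.2.1 (σ.symm i)
  fin_cases e <;> simp [winding, cubeAntipode, posPart_def] <;> grind

theorem winding_injective_of_same_cylinder {w w' : cubeSphere d} {θ θ' r : ℝ}
    (hθ : θ ∈ Set.Icc 0 1) (hθ' : θ' ∈ Set.Icc 0 1) (hr : 0 < r)
    (h : ∀ p, winding σ w (c.val + θ) p = r * winding σ w' (c.val + θ') p) :
    w = w' ∧ θ = θ' := by
  rw [winding_add w.2 c hθ, winding_add w'.2 c hθ'] at h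
  obtain ⟨hw, hθθ'⟩ :=
    cylinderPoint_injective (unwind_mem_cubeSphere w.2) (unwind_mem_cubeSphere w'.2) hr h
  exact ⟨Subtype.ext ((unwind_involutive c).injective hw), hθθ'⟩

theorem exists_same_cylinder_or_ends {T T' : ℝ} (hT : 0 ≤ T) (hTT' : T ≤ T') (hT' : T' ≤ 3)
    (h1 : 1 ≤ |T - 1| ↔ 1 ≤ |T' - 1|) (h2 : 1 ≤ |T - 2| ↔ 1 ≤ |T' - 2|) :
    (∃ c : Fin 3, T - c.val ∈ Set.Icc 0 1 ∧ T' - c.val ∈ Set.Icc 0 1) ∨ T = 0 ∧ T' = 3 := by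
  simp only [le_abs] at h1 h2
  by_cases a : T' ≤ 1
  · exact Or.inl ⟨0, by constructor <;> constructor <;> simp <;> linarith⟩
  by_cases b : 1 ≤ T ∧ T' ≤ 2
  · exact Or.inl ⟨1, by constructor <;> constructor <;> simp <;> linarith⟩
  by_cases e : 2 ≤ T
  · exact Or.inl ⟨2, by constructor <;> constructor <;> simp <;> linarith⟩
  · exact Or.inr (by grind)

theorem winding_injective {w w' : cubeSphere d} {T T' r : ℝ} (hT : 0 ≤ T) (hTT' : T ≤ T')
    (hT' : T' ≤ 3) (hr : 0 < r) (h : ∀ p, winding σ w T p = r * winding σ w' T' p) :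
    (w = w' ∧ T = T') ∨ (T = 0 ∧ T' = 3 ∧ w' = cubeAntipode σ w) := by
  have hzero : ∀ p, winding σ w T p = 0 ↔ winding σ w' T' p = 0 := fun p => by
    rw [h p, mul_eq_zero_iff_left hr.ne']
  have hone : 1 ≤ |T - 1| ↔ 1 ≤ |T' - 1| := by
    rw [← winding_one_eq_zero_iff w.2, ← winding_one_eq_zero_iff w'.2]
    exact forall_congr' fun i => hzero (1, i)
  have htwo : 1 ≤ |T - 2| ↔ 1 ≤ |T' - 2| := by
    rw [← winding_two_eq_zero_iff w.2, ← winding_two_eq_zero_iff w'.2]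
    exact forall_congr' fun i => hzero (2, i)
  rcases exists_same_cylinder_or_ends hT hTT' hT' hone htwo with ⟨c, hc, hc'⟩ | ⟨rfl, rfl⟩
  · obtain ⟨hw, hθ⟩ := winding_injective_of_same_cylinder (c := c) hc hc' hr (by simpa using h)
    exact Or.inl ⟨hw, by linarith⟩
  · rw [winding_zero_eq_winding_three] at h
    have hthree : (3 : ℝ) = (2 : Fin 3).val + 1 := by norm_num
    rw [hthree] at h
    exact Or.inr ⟨rfl, rfl, (winding_injective_of_same_cylinder (c := 2)
      (Set.right_mem_Icc.mpr zero_le_one) (Set.right_mem_Icc.mpr zero_le_one) hr h).1.symm⟩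

theorem sum_winding_pos (w : cubeSphere d) {T : ℝ} (hT : T ∈ Set.Icc 0 3) :
    0 < ∑ p, winding σ w T p := by
  obtain ⟨c, θ, hθ, rfl⟩ := exists_eq_add hT
  rw [winding_add w.2 c hθ]
  obtain ⟨p, hp⟩ := exists_cylinderPoint_pos (unwind_mem_cubeSphere w.2) θ
  exact Finset.sum_pos' (fun q _ => cylinderPoint_nonneg _ θ q) ⟨p, Finset.mem_univ _, hp⟩

theorem winding_div_sum_mem_polyhedron (w : cubeSphere d) {T : ℝ} (hT : T ∈ Set.Icc 0 3) :
    (fun q => winding σ w T q / ∑ q, winding σ w T q) ∈ polyhedron (crossTorus σ) := by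
  have hsum := sum_winding_pos (σ := σ) w hT
  obtain ⟨c, θ, hθ, rfl⟩ := exists_eq_add hT
  rw [winding_add w.2 c hθ] at hsum ⊢
  obtain ⟨s, hs, hsx⟩ := exists_isCylinderFace_cylinderPoint (σ := σ) (c := c)
    (unwind_mem_cubeSphere (c := c) w.2) hθ
  refine ⟨⟨fun q => div_nonneg (cylinderPoint_nonneg _ _ _) hsum.le, ?_⟩, s, ⟨c, hs⟩,
    fun q hq => by simp only [hsx q hq, zero_div]⟩
  rw [← Finset.sum_div]
  exact div_self hsum.ne'

theorem exists_winding_eq_mul {x : Fin 3 × Fin d → ℝ} (hx : x ∈ polyhedron (crossTorus σ)) :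
    ∃ w : cubeSphere d, ∃ T ∈ Set.Icc (0 : ℝ) 3, ∃ r > 0, ∀ p, winding σ w T p = r * x p := by
  obtain ⟨⟨h0, h1⟩, s, ⟨c, hs⟩, hsx⟩ := hx
  have hx0 : x ≠ 0 := fun hx0 => by simp [hx0] at h1
  obtain ⟨w, hw, θ, hθ, r, hr, hwx⟩ := hs.exists_cylinderPoint_eq h0 hx0 hsx
  have hc : ((c : ℕ) : ℝ) ≤ 2 := by exact_mod_cast Nat.le_of_lt_succ c.isLt
  refine ⟨⟨_, unwind_mem_cubeSphere (c := c) hw⟩, c.val + θ,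
    ⟨add_nonneg (Nat.cast_nonneg _) hθ.1, by linarith [hθ.2]⟩, r, hr, fun p => ?_⟩
  rw [winding_add (unwind_mem_cubeSphere hw) c hθ, unwind_involutive c w, hwx]

theorem three_mul_mem_Icc (t : unitInterval) : 3 * (t : ℝ) ∈ Set.Icc (0 : ℝ) 3 :=
  ⟨by linarith [t.2.1], by linarith [t.2.2]⟩

/-- The winding at time `3 t`, normalised to a point of the polyhedron. -/
noncomputable def windingMap (σ : Equiv.Perm (Fin d)) (p : cubeSphere d × unitInterval) :
    polyhedron (crossTorus σ) :=
  ⟨_, winding_div_sum_mem_polyhedron p.1 (three_mul_mem_Icc p.2)⟩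

theorem continuous_windingMap : Continuous (windingMap σ) := by
  have hwinding : ∀ q, Continuous fun p : cubeSphere d × unitInterval =>
      winding σ p.1 (3 * p.2) q := fun q =>
    (continuous_winding σ q).comp (f := fun p : cubeSphere d × unitInterval =>
      ((p.1 : Fin d → ℝ), (3 * p.2 : ℝ))) (by fun_prop)
  exact Continuous.subtype_mk (continuous_pi fun q => (hwinding q).div
    (continuous_finsetSum _ fun q _ => hwinding q)
    fun p => (sum_winding_pos p.1 (three_mul_mem_Icc p.2)).ne') _

theorem windingMap_surjective : Function.Surjective (windingMap σ) := by
  rintro ⟨x, hx⟩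
  obtain ⟨w, T, hT, r, hr, hwx⟩ := exists_winding_eq_mul hx
  refine ⟨(w, ⟨T / 3, by linarith [hT.1], by linarith [hT.2]⟩), Subtype.ext (funext fun q => ?_)⟩
  simp only [windingMap, mul_div_cancel₀ T three_ne_zero, hwx, ← Finset.mul_sum, hx.1.2, mul_one]
  exact mul_div_cancel_left₀ _ hr.ne'

theorem eq_of_windingMap_eq {p q : cubeSphere d × unitInterval} (hpq : p.2 ≤ q.2)
    (h : windingMap σ p = windingMap σ q) :
    p = q ∨ (p.2 = 0 ∧ q.2 = 1 ∧ q.1 = cubeAntipode σ p.1) := by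
  obtain ⟨⟨w, t⟩, w', t'⟩ := p, q
  have hp := sum_winding_pos (σ := σ) w (three_mul_mem_Icc t)
  have hq := sum_winding_pos (σ := σ) w' (three_mul_mem_Icc t')
  have hscale : ∀ i, winding σ w (3 * t) i = (∑ i, winding σ w (3 * t) i) /
      (∑ i, winding σ w' (3 * t') i) * winding σ w' (3 * t') i := fun i => by
    have := (div_eq_div_iff hp.ne' hq.ne').mp (congrFun (congrArg Subtype.val h) i)
    field_simp
    linarith
  rcases winding_injective (three_mul_mem_Icc t).1 (by gcongr)
    (three_mul_mem_Icc t').2 (div_pos hp hq) hscale with ⟨rfl, htt'⟩ | ⟨ht, ht', hw⟩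
  · exact Or.inl (Prod.ext rfl (Subtype.ext (by simpa using htt')))
  · exact Or.inr ⟨Subtype.ext (by simpa using ht), Subtype.ext (by simpa using ht'), hw⟩

theorem nonempty_homeomorph_crossTorus (σ : Equiv.Perm (Fin d)) [CompactSpace (cubeSphere d)] :
    Nonempty (MappingTorus (cubeAntipode σ) ≃ₜ polyhedron (crossTorus σ)) :=
  MappingTorus.nonempty_homeomorph continuous_windingMap windingMap_surjective
    (fun w => Subtype.ext (by simp [windingMap, winding_zero_eq_winding_three]))
    fun _ _ => eq_of_windingMap_eq

end CrossTorus

section Reflections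

section InnerProductSpace

variable {E : Type*} [NormedAddCommGroup E] [InnerProductSpace ℝ E]

/-- The reflection of the unit sphere in the hyperplane orthogonal to its point `u`. -/
noncomputable def hyperplaneReflection (u x : Metric.sphere (0 : E) 1) : Metric.sphere (0 : E) 1 :=
  ⟨(ℝ ∙ (u : E))ᗮ.reflection x, by
    rw [mem_sphere_zero_iff_norm, LinearIsometryEquiv.norm_map, norm_eq_of_mem_sphere]⟩

theorem hyperplaneReflection_coe (u x : Metric.sphere (0 : E) 1) :
    (hyperplaneReflection u x : E) = x - (2 * inner ℝ (u : E) x) • (u : E) := by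
  change (ℝ ∙ (u : E))ᗮ.reflection x = _
  rw [Submodule.reflection_orthogonal_apply, Submodule.reflection_singleton_apply,
    norm_eq_of_mem_sphere]
  simp [mul_smul, two_smul]

theorem hyperplaneReflection_involutive (u : Metric.sphere (0 : E) 1) :
    Function.Involutive (hyperplaneReflection u) :=
  fun _ => Subtype.ext (Submodule.reflection_reflection _ _)

theorem continuous_hyperplaneReflection {Y : Type*} [TopologicalSpace Y]
    {f g : Y → Metric.sphere (0 : E) 1} (hf : Continuous f) (hg : Continuous g) :
    Continuous fun y => hyperplaneReflection (f y) (g y) := by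
  refine continuous_induced_rng.mpr ?_
  simp only [Function.comp_def, hyperplaneReflection_coe]
  fun_prop

theorem nonempty_homeomorph_of_joined {u v : Metric.sphere (0 : E) 1} (huv : Joined u v)
    (g : Metric.sphere (0 : E) 1 → Metric.sphere (0 : E) 1) :
    Nonempty (MappingTorus (hyperplaneReflection u ∘ g) ≃ₜ
      MappingTorus (hyperplaneReflection v ∘ g)) := by
  obtain ⟨γ⟩ := huv
  have hu := hyperplaneReflection_involutive u
  have hγ := fun t => hyperplaneReflection_involutive (γ t)
  let P : unitInterval → Metric.sphere (0 : E) 1 → Metric.sphere (0 : E) 1 := fun t x =>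
    hyperplaneReflection (γ t) (hyperplaneReflection u x)
  let Q : unitInterval → Metric.sphere (0 : E) 1 → Metric.sphere (0 : E) 1 := fun t x =>
    hyperplaneReflection u (hyperplaneReflection (γ t) x)
  have hP : Continuous fun p : Metric.sphere (0 : E) 1 × unitInterval => P p.2 p.1 :=
    continuous_hyperplaneReflection (γ.continuous.comp continuous_snd)
      (continuous_hyperplaneReflection continuous_const continuous_fst)
  have hQ : Continuous fun p : Metric.sphere (0 : E) 1 × unitInterval => Q p.2 p.1 :=
    continuous_hyperplaneReflection continuous_const
      (continuous_hyperplaneReflection (γ.continuous.comp continuous_snd) continuous_fst)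
  have hQP : ∀ t, Function.LeftInverse (P t) (Q t) := fun t x => by
    simp only [P, Q, hu _, hγ t _]
  have hPQ : ∀ t, Function.LeftInverse (Q t) (P t) := fun t x => by
    simp only [P, Q, hu _, hγ t _]
  have hP0 : ∀ x, P 0 x = x := fun x => by simp only [P, γ.source, hu x]
  have hP1 : P 1 ∘ hyperplaneReflection u ∘ g = hyperplaneReflection v ∘ g := by
    funext x
    simp only [P, Function.comp_apply, γ.target, hu (g x)]
  exact ⟨hP1 ▸ MappingTorus.isotopy P Q hP hQ hQP hPQ hP0 (hyperplaneReflection u ∘ g)⟩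

theorem nonempty_homeomorph_hyperplaneReflection (hE : 1 < Module.rank ℝ E)
    (u v : Metric.sphere (0 : E) 1) (g : Metric.sphere (0 : E) 1 → Metric.sphere (0 : E) 1) :
    Nonempty (MappingTorus (hyperplaneReflection u ∘ g) ≃ₜ
      MappingTorus (hyperplaneReflection v ∘ g)) :=
  nonempty_homeomorph_of_joined ((isPathConnected_iff_pathConnectedSpace.mp
    (isPathConnected_sphere hE 0 zero_le_one)).joined u v) g

end InnerProductSpace

variable {n : ℕ}

/-- The `i`-th standard basis vector, as a point of the unit sphere. -/
noncomputable def basisPoint (i : Fin (n + 1)) : UnitSphere n :=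
  ⟨EuclideanSpace.single i 1, by simp⟩

theorem reflection_basisPoint_apply (i j : Fin (n + 1)) (x : EuclideanSpace ℝ (Fin (n + 1))) :
    (ℝ ∙ (basisPoint i).1)ᗮ.reflection x j = if j = i then -x j else x j := by
  rw [Submodule.reflection_orthogonal_apply, Submodule.reflection_singleton_apply,
    norm_eq_of_mem_sphere]
  by_cases hji : j = i
  · subst hji
    simp [basisPoint, EuclideanSpace.inner_single_left]
    ring
  · simp [basisPoint, hji]

theorem sphereReflection_eq_hyperplaneReflection (n : ℕ) :
    sphereReflection n = hyperplaneReflection (basisPoint 0) := by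
  funext x
  refine Subtype.ext (PiLp.ext fun j => ?_)
  exact (reflection_basisPoint_apply 0 j x).symm

theorem sphereReflection_involutive (n : ℕ) : Function.Involutive (sphereReflection n) :=
  sphereReflection_eq_hyperplaneReflection n ▸ hyperplaneReflection_involutive _

theorem continuous_sphereReflection (n : ℕ) : Continuous (sphereReflection n) := by
  rw [sphereReflection_eq_hyperplaneReflection]
  exact continuous_hyperplaneReflection continuous_const continuous_id

/-- The reflection of the unit sphere as a homeomorphism. -/
noncomputable def sphereReflectionHomeomorph (n : ℕ) : UnitSphere n ≃ₜ UnitSphere n where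
  toEquiv := (sphereReflection_involutive n).toPerm
  continuous_toFun := continuous_sphereReflection n
  continuous_invFun := continuous_sphereReflection n

/-- The map of the unit sphere that changes the signs of the coordinates in `S`. -/
noncomputable def negOn (S : Finset (Fin (n + 1))) (x : UnitSphere n) : UnitSphere n :=
  ⟨WithLp.toLp 2 fun i => if i ∈ S then -(x.1 i) else x.1 i, by
    refine mem_sphere_zero_iff_norm.mpr (Eq.trans ?_ (norm_eq_of_mem_sphere x))
    rw [EuclideanSpace.norm_eq, EuclideanSpace.norm_eq]
    refine congrArg _ (Finset.sum_congr rfl fun i _ => ?_)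
    by_cases hi : i ∈ S <;> simp [hi]⟩

theorem negOn_empty : negOn (∅ : Finset (Fin (n + 1))) = id :=
  funext fun x => Subtype.ext (PiLp.ext fun j => by simp [negOn])

theorem negOn_univ : negOn (Finset.univ : Finset (Fin (n + 1))) = fun x => -x :=
  funext fun x => Subtype.ext (PiLp.ext fun j => by simp [negOn])

theorem negOn_insert {S : Finset (Fin (n + 1))} {i : Fin (n + 1)} (hi : i ∉ S) :
    negOn (insert i S) = hyperplaneReflection (basisPoint i) ∘ negOn S := by
  funext x
  refine Subtype.ext (PiLp.ext fun j => ?_)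
  refine Eq.trans ?_ (reflection_basisPoint_apply i j (negOn S x)).symm
  by_cases hji : j = i <;> simp [negOn, hji, hi]

theorem commute_sphereReflection_negOn (S : Finset (Fin (n + 1))) :
    Function.Commute (sphereReflection n) (negOn S) := by
  intro x
  refine Subtype.ext (PiLp.ext fun j => ?_)
  rcases eq_or_ne j 0 with rfl | hj
  · by_cases hS : 0 ∈ S <;> simp [sphereReflection, negOn, hS]
  · simp [sphereReflection, negOn, hj]

/-- All coordinate reflections are isotopic, so that changing the signs of `k` coordinates amounts
to reflecting `k` times in the first one. -/
theorem nonempty_homeomorph_negOn (S : Finset (Fin (n + 2))) (a : ℕ) :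
    Nonempty (MappingTorus (negOn S ∘ (sphereReflection (n + 1))^[a]) ≃ₜ
      MappingTorus (sphereReflection (n + 1))^[S.card + a]) := by
  induction S using Finset.induction_on generalizing a with
  | empty => rw [negOn_empty, Finset.card_empty, zero_add]; exact ⟨Homeomorph.refl _⟩
  | insert i S hi ih =>
    obtain ⟨e⟩ := nonempty_homeomorph_hyperplaneReflection
      (by rw [← Module.finrank_eq_rank, finrank_euclideanSpace_fin]; norm_cast; omega)
      (basisPoint i) (basisPoint 0) (negOn S ∘ (sphereReflection (n + 1))^[a])
    rw [← Function.comp_assoc, ← negOn_insert hi, ← sphereReflection_eq_hyperplaneReflection,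
      ← Function.comp_assoc, (commute_sphereReflection_negOn S).comp_eq, Function.comp_assoc,
      ← Function.iterate_succ'] at e
    obtain ⟨e'⟩ := ih (a + 1)
    rw [Finset.card_insert_of_notMem hi, add_right_comm, add_assoc]
    exact ⟨e.trans e'⟩

theorem nonempty_homeomorph_neg_iterate (n a : ℕ) :
    Nonempty (MappingTorus (fun x => -(sphereReflection (n + 1))^[a] x) ≃ₜ
      MappingTorus (sphereReflection (n + 1))^[n + 2 + a]) := by
  have h := nonempty_homeomorph_negOn (n := n) Finset.univ a
  rw [negOn_univ, Finset.card_univ, Fintype.card_fin] at h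
  exact h

end Reflections

section SphereModel

variable {n : ℕ}

instance compactSpace_cubeSphere (d : ℕ) : CompactSpace (cubeSphere d) := by
  have hcube : IsCompact (Set.Icc (0 : Fin d → ℝ) 1) := isCompact_Icc
  refine isCompact_iff_compactSpace.mp (hcube.of_isClosed_subset ?_ fun w hw => ⟨hw.1, hw.2.1⟩)
  have hvalue : ∀ a : ℝ, IsClosed {w : Fin d → ℝ | ∃ i, w i = a} := fun a => by
    simp only [Set.ofPred_exists]
    exact isClosed_iUnion_of_finite fun i => isClosed_eq (continuous_apply i) continuous_const
  have hIcc : cubeSphere d =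
      Set.Icc 0 1 ∩ ({w | ∃ i, w i = 0} ∩ {w | ∃ i, w i = 1}) := by
    ext w
    exact ⟨fun ⟨h0, h1, h⟩ => ⟨⟨h0, h1⟩, h⟩, fun ⟨⟨h0, h1⟩, h⟩ => ⟨h0, h1, h⟩⟩
  rw [hIcc]
  exact isClosed_Icc.inter ((hvalue 0).inter (hvalue 1))

/-- Coordinates on the quotient of `ℝⁿ⁺²` by the line of constant vectors, chosen so that the
exchange of the first two coordinates becomes the reflection in the first coordinate. -/
noncomputable def quotientCoordinates (n : ℕ) :
    (Fin (n + 2) → ℝ) →ₗ[ℝ] EuclideanSpace ℝ (Fin (n + 1)) where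
  toFun v := WithLp.toLp 2 (Fin.cons ((v 0 - v 1) / 2) fun i => v i.succ.succ - (v 0 + v 1) / 2)
  map_add' v w := by
    ext i
    refine Fin.cases ?_ (fun i => ?_) i <;> simp <;> ring
  map_smul' r v := by
    ext i
    refine Fin.cases ?_ (fun i => ?_) i <;> simp <;> ring

@[simp] theorem quotientCoordinates_zero (v : Fin (n + 2) → ℝ) :
    quotientCoordinates n v 0 = (v 0 - v 1) / 2 := rfl

@[simp] theorem quotientCoordinates_succ (v : Fin (n + 2) → ℝ) (i : Fin n) :
    quotientCoordinates n v i.succ = v i.succ.succ - (v 0 + v 1) / 2 := rfl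

theorem quotientCoordinates_eq_zero_iff {v : Fin (n + 2) → ℝ} :
    quotientCoordinates n v = 0 ↔ ∀ i, v i = v 0 := by
  constructor
  · intro h
    have hcoord : ∀ i, quotientCoordinates n v i = 0 := fun i => by rw [h, PiLp.zero_apply]
    have h01 := hcoord 0
    rw [quotientCoordinates_zero] at h01
    refine Fin.cases rfl (Fin.cases ?_ fun i => ?_)
    · exact (by linarith : v 1 = v 0)
    · have := hcoord i.succ
      rw [quotientCoordinates_succ] at this
      linarith
  · intro h
    ext i
    refine Fin.cases ?_ (fun i => ?_) i
    · simp [h 1]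
    · simp [h 1, h i.succ.succ]

theorem quotientCoordinates_surjective (n : ℕ) : Function.Surjective (quotientCoordinates n) := by
  intro u
  refine ⟨Fin.cons (u 0) (Fin.cons (-u 0) fun i => u i.succ), ?_⟩
  ext i
  refine Fin.cases ?_ (fun i => ?_) i
  · exact (by ring : (u 0 - -u 0) / 2 = u 0)
  · exact (by ring : u i.succ - (u 0 + -u 0) / 2 = u i.succ)

theorem quotientCoordinates_smul_add_const (r : ℝ) (v : Fin (n + 2) → ℝ) (k : ℝ) :
    quotientCoordinates n (fun i => r * v i + k) = r • quotientCoordinates n v := by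
  have hconst : quotientCoordinates n (fun _ => k) = 0 :=
    quotientCoordinates_eq_zero_iff.mpr fun _ => rfl
  exact (map_add _ (r • v) fun _ => k).trans (by rw [hconst, add_zero, map_smul])

theorem quotientCoordinates_ne_zero {w : Fin (n + 2) → ℝ} (hw : w ∈ cubeSphere (n + 2)) :
    quotientCoordinates n w ≠ 0 := by
  intro h
  obtain ⟨-, -, ⟨i, hi⟩, ⟨j, hj⟩⟩ := hw
  have hconst := quotientCoordinates_eq_zero_iff.mp h
  exact zero_ne_one (hi.symm.trans ((hconst i).trans ((hconst j).symm.trans hj)))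

/-- The radial projection of `cubeSphere (n + 2)` to the unit sphere. -/
noncomputable def toUnitSphere (w : cubeSphere (n + 2)) : UnitSphere n :=
  ⟨‖quotientCoordinates n w‖⁻¹ • quotientCoordinates n w, by
    rw [mem_sphere_zero_iff_norm, norm_smul, norm_inv, norm_norm]
    exact inv_mul_cancel₀ (norm_ne_zero_iff.mpr (quotientCoordinates_ne_zero w.2))⟩

theorem continuous_toUnitSphere : Continuous (toUnitSphere (n := n)) := by
  have h : Continuous fun w : cubeSphere (n + 2) => quotientCoordinates n w :=
    (quotientCoordinates n).continuous_of_finiteDimensional.comp continuous_subtype_val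
  exact ((h.norm.inv₀ fun w => norm_ne_zero_iff.mpr (quotientCoordinates_ne_zero w.2)).smul
    h).subtype_mk _

theorem toUnitSphere_injective : Function.Injective (toUnitSphere (n := n)) := by
  intro w w' h
  have ha := norm_pos_iff.mpr (quotientCoordinates_ne_zero w.2)
  have hb := norm_pos_iff.mpr (quotientCoordinates_ne_zero w'.2)
  set a := ‖quotientCoordinates n w‖
  set b := ‖quotientCoordinates n w'‖
  have hscale : quotientCoordinates n w = (a / b) • quotientCoordinates n w' := by
    have hsphere : a⁻¹ • quotientCoordinates n w = b⁻¹ • quotientCoordinates n w' :=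
      congrArg Subtype.val h
    rw [div_eq_mul_inv, mul_smul, ← hsphere, smul_inv_smul₀ ha.ne']
  have hconst : ∀ i, w.1 i - a / b * w'.1 i = w.1 0 - a / b * w'.1 0 :=
    quotientCoordinates_eq_zero_iff.mp
      (show quotientCoordinates n (w.1 - (a / b) • w'.1) = 0 by
        rw [map_sub, map_smul, hscale, sub_self])
  have haffine : ∀ i, w.1 i = a / b * w'.1 i + (w.1 0 - a / b * w'.1 0) :=
    fun i => by linarith [hconst i]
  obtain ⟨hr, hk⟩ := affine_eq_id_of_mem_cubeSphere w.2 w'.2 (div_pos ha hb) haffine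
  exact Subtype.ext (funext fun i => by rw [haffine, hk, hr, one_mul, add_zero])

theorem toUnitSphere_surjective : Function.Surjective (toUnitSphere (n := n)) := by
  intro u
  obtain ⟨v, hv⟩ := quotientCoordinates_surjective n u.1
  have hu : ‖u.1‖ = 1 := mem_sphere_zero_iff_norm.mp u.2
  have hv' : ∃ i j, v i ≠ v j := by
    by_contra! hconst
    rw [← hv, quotientCoordinates_eq_zero_iff.mpr fun i => hconst i 0, norm_zero] at hu
    exact zero_ne_one hu
  obtain ⟨r, hr, k, hw⟩ := exists_affine_mem_cubeSphere hv'
  refine ⟨⟨_, hw⟩, Subtype.ext ?_⟩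
  simp only [toUnitSphere, quotientCoordinates_smul_add_const, hv, norm_smul, hu, mul_one,
    Real.norm_of_nonneg hr.le, inv_smul_smul₀ hr.ne']

/-- The model `cubeSphere (n + 2)` is homeomorphic to the unit sphere. -/
noncomputable def cubeSphereHomeomorph (n : ℕ) : cubeSphere (n + 2) ≃ₜ UnitSphere n :=
  Continuous.homeoOfEquivCompactToT2
    (f := Equiv.ofBijective _ ⟨toUnitSphere_injective, toUnitSphere_surjective⟩)
    continuous_toUnitSphere

theorem coe_toUnitSphere_of_linearIsometryEquiv {w w' : cubeSphere (n + 2)}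
    (L : EuclideanSpace ℝ (Fin (n + 1)) ≃ₗᵢ[ℝ] EuclideanSpace ℝ (Fin (n + 1)))
    (h : quotientCoordinates n w' = L (quotientCoordinates n w)) :
    (toUnitSphere w').1 = L (toUnitSphere w).1 := by
  simp only [toUnitSphere, h, L.norm_map, L.map_smul]

theorem toUnitSphere_antipode (w : cubeSphere (n + 2)) :
    toUnitSphere (cubeAntipode 1 w) = -toUnitSphere w := by
  refine Subtype.ext (coe_toUnitSphere_of_linearIsometryEquiv (LinearIsometryEquiv.neg ℝ) ?_)
  change _ = -quotientCoordinates n w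
  rw [← neg_one_smul ℝ, ← quotientCoordinates_smul_add_const _ _ 1]
  exact congrArg _ (funext fun i => by simp [cubeAntipode, neg_add_eq_sub])

theorem toUnitSphere_antipode_swap (w : cubeSphere (n + 2)) :
    toUnitSphere (cubeAntipode (Equiv.swap 0 1) w) = -sphereReflection n (toUnitSphere w) := by
  rw [sphereReflection_eq_hyperplaneReflection]
  refine Subtype.ext (coe_toUnitSphere_of_linearIsometryEquiv
    ((ℝ ∙ (basisPoint 0).1)ᗮ.reflection.trans (LinearIsometryEquiv.neg ℝ)) (PiLp.ext fun i => ?_))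
  change _ = -(ℝ ∙ (basisPoint 0).1)ᗮ.reflection (quotientCoordinates n w) i
  rw [reflection_basisPoint_apply]
  refine Fin.cases ?_ (fun i => ?_) i
  · simp [cubeAntipode]
  · have hswap : Equiv.swap (0 : Fin (n + 2)) 1 i.succ.succ = i.succ.succ :=
      Equiv.swap_apply_of_ne_of_ne (Fin.succ_ne_zero _) (by simp [Fin.ext_iff])
    simp [cubeAntipode, hswap]
    ring

theorem nonempty_homeomorph_crossTorus_one (n : ℕ) :
    Nonempty (polyhedron (crossTorus (1 : Equiv.Perm (Fin (n + 3)))) ≃ₜ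
      MappingTorus (sphereReflection (n + 1))^[n + 2]) := by
  obtain ⟨e⟩ := nonempty_homeomorph_crossTorus (1 : Equiv.Perm (Fin (n + 3)))
  obtain ⟨e'⟩ := nonempty_homeomorph_neg_iterate n 0
  exact ⟨e.symm.trans ((MappingTorus.conj (cubeSphereHomeomorph (n + 1))
    toUnitSphere_antipode).trans e')⟩

theorem nonempty_homeomorph_crossTorus_swap (n : ℕ) :
    Nonempty (polyhedron (crossTorus (Equiv.swap (0 : Fin (n + 3)) 1)) ≃ₜ
      MappingTorus (sphereReflection (n + 1))^[n + 3]) := by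
  obtain ⟨e⟩ := nonempty_homeomorph_crossTorus (Equiv.swap (0 : Fin (n + 3)) 1)
  obtain ⟨e'⟩ := nonempty_homeomorph_neg_iterate n 1
  exact ⟨e.symm.trans ((MappingTorus.conj (cubeSphereHomeomorph (n + 1))
    toUnitSphere_antipode_swap).trans e')⟩

end SphereModel

section Stellar

variable {V : Type*} [DecidableEq V] {K : Set (Finset V)} {A t : Finset V} {b v x y p r : V}

omit [DecidableEq V] in
theorem notMem_of_singleton_notMem (hK : IsLowerSet K) (hb : {b} ∉ K) (ht : t ∈ K) : b ∉ t :=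
  fun hbt => hb (hK (Finset.singleton_subset_iff.mpr hbt) ht)

theorem mem_bistellar_pair :
    t ∈ bistellar K {x, y} {p, r} ↔
      ¬(x ∈ t ∧ y ∈ t) ∧ (t ∈ K ∨ (p ∈ t ∧ r ∈ t) ∧ t \ {p, r} ∪ {x, y} ∈ K) := by
  simp only [bistellar, Set.mem_ofPred_eq, Finset.insert_subset_iff, Finset.singleton_subset_iff]

theorem mem_stellar_pair :
    t ∈ stellar K {x, y} b ↔ ¬(x ∈ t ∧ y ∈ t) ∧ (t ∈ K ∨ b ∈ t ∧ t \ {b} ∪ {x, y} ∈ K) := by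
  simp only [bistellar, Set.mem_ofPred_eq, Finset.insert_subset_iff, Finset.singleton_subset_iff]

theorem singleton_mem_stellar_pair (hxy : x ≠ y) (hv : {v} ∈ K) : {v} ∈ stellar K {x, y} b :=
  mem_stellar_pair.mpr ⟨by grind, Or.inl hv⟩

theorem singleton_new_mem_stellar (hA : A.Nonempty) (hAK : A ∈ K) (hb : b ∉ A) :
    {b} ∈ stellar K A b := by
  obtain ⟨a, ha⟩ := hA
  refine ⟨fun h => hb (Finset.mem_singleton.mp (h ha) ▸ ha), Or.inr ⟨subset_rfl, ?_⟩⟩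
  rwa [Finset.sdiff_self, Finset.empty_union]

theorem exists_mem_stellar_card_eq (hK : IsLowerSet K) (hb : {b} ∉ K) (hx : x ∈ A) (hbA : b ∉ A)
    {s : Finset V} (hs : s ∈ K) :
    ∃ s' ∈ stellar K A b, s'.card = s.card ∧ s' ⊆ insert b s ∧ (x ∉ s → s' = s) := by
  by_cases hAs : A ⊆ s
  · have hbs := notMem_of_singleton_notMem hK hb hs
    refine ⟨insert b (s.erase x), ⟨fun h => ?_, Or.inr ⟨by simp, hK (by grind) hs⟩⟩, ?_, ?_,
      fun h => absurd (hAs hx) h⟩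
    · have := h hx
      grind
    · rw [Finset.card_insert_of_notMem (by grind), Finset.card_erase_add_one (hAs hx)]
    · exact Finset.insert_subset_insert b (Finset.erase_subset x s)
  · exact ⟨s, ⟨hAs, Or.inl hs⟩, rfl, Finset.subset_insert b s, fun _ => rfl⟩

/-- `K` has two disjoint faces with `d` vertices. -/
def HasDisjointFacets (K : Set (Finset V)) (d : ℕ) : Prop :=
  ∃ s ∈ K, ∃ t ∈ K, Disjoint s t ∧ s.card = d ∧ t.card = d

theorem HasDisjointFacets.stellar {d : ℕ} (h : HasDisjointFacets K d) (hK : IsLowerSet K)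
    (hb : {b} ∉ K) (hA : A.Nonempty) (hbA : b ∉ A) : HasDisjointFacets (stellar K A b) d := by
  obtain ⟨s, hs, t, ht, hst, hsd, htd⟩ := h
  obtain ⟨x, hx⟩ := hA
  obtain ⟨s', hs', hss', hs's, hs'x⟩ := exists_mem_stellar_card_eq hK hb hx hbA hs
  obtain ⟨t', ht', htt', ht't, ht'x⟩ := exists_mem_stellar_card_eq hK hb hx hbA ht
  refine ⟨s', hs', t', ht', ?_, hss'.trans hsd, htt'.trans htd⟩
  have hbs := notMem_of_singleton_notMem hK hb hs
  have hbt := notMem_of_singleton_notMem hK hb ht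
  by_cases hxs : x ∈ s
  · rw [ht'x (Finset.disjoint_left.mp hst hxs)]
    exact Finset.disjoint_of_subset_left hs's (Finset.disjoint_insert_left.mpr ⟨hbt, hst⟩)
  · rw [hs'x hxs]
    exact Finset.disjoint_of_subset_right ht't (Finset.disjoint_insert_right.mpr ⟨hbs, hst⟩)

end Stellar

section Rainbow

variable {V C : Type*} {K : Set (Finset V)} {κ : V → C}

/-- The faces of `K` are rainbow for the colouring `κ`. -/
def IsRainbow (K : Set (Finset V)) (κ : V → C) : Prop :=
  ∀ s ∈ K, Set.InjOn κ s

theorem IsRainbow.eq (hκ : IsRainbow K κ) {s : Finset V} (hs : s ∈ K) :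
    ∀ x ∈ s, ∀ y ∈ s, κ x = κ y → x = y :=
  fun _ hx _ hy hxy => hκ s hs hx hy hxy

/-- The vertices `p, q, r, s` form a path in the link of `w`, coloured alternately, whose inner
vertices have no other neighbours in the colours of the path; the disc `w * pqrs` can then be
retriangulated with one more vertex. -/
structure HasAlternatingPath [DecidableEq V] (K : Set (Finset V)) (κ : V → C) (w p q r s : V) :
    Prop where
  mem : {w, q, r} ∈ K
  ends : {p, s} ∉ K
  color_pr : κ p = κ r
  color_qs : κ q = κ s
  ne_wq : κ w ≠ κ q
  ne_wr : κ w ≠ κ r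
  ne_qr : κ q ≠ κ r
  ne_pr : p ≠ r
  ne_qs : q ≠ s
  link_q : ∀ t ∈ K, w ∈ t → q ∈ t → p ∉ t → r ∉ t → insert p t ∈ K ∧ insert r t ∈ K
  link_r : ∀ t ∈ K, w ∈ t → r ∈ t → q ∉ t → s ∉ t → insert q t ∈ K ∧ insert s t ∈ K

end Rainbow

section SubdivideEdge

variable {V C : Type*} [DecidableEq V] {K : Set (Finset V)} {κ : V → C} {t : Finset V}
  {u v w a b : V}

/-- The two subdivisions replace the edge `u v` by the path `u b a v`. -/
theorem mem_subdivideEdge (hK : IsLowerSet K) (ha : {a} ∉ K) (hb : {b} ∉ K) (hab : a ≠ b)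
    (huvK : {u, v} ∈ K) (huv : u ≠ v) :
    t ∈ stellar (stellar K {u, v} b) {b, v} a ↔
      ¬(u ∈ t ∧ v ∈ t) ∧ ¬(u ∈ t ∧ a ∈ t) ∧ ¬(b ∈ t ∧ v ∈ t) ∧
        (t ∈ K ∨ (a ∈ t ∨ b ∈ t) ∧ t \ {a, b} ∪ {u, v} ∈ K) := by
  have ha' := fun t => notMem_of_singleton_notMem (t := t) hK ha
  have hb' := fun t => notMem_of_singleton_notMem (t := t) hK hb
  have hauv := ha' _ huvK
  have hbuv := hb' _ huvK
  have hsdiff : (t \ {a} ∪ {b, v}) \ {b} ∪ {u, v} = t \ {a, b} ∪ {u, v} := by grind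
  have hsdiff_b : a ∉ t → t \ {b} ∪ {u, v} = t \ {a, b} ∪ {u, v} := by grind
  have hb_t := hb' (t \ {a} ∪ {b, v})
  have ha_t := ha' (t \ {b} ∪ {u, v})
  simp only [mem_stellar_pair, hsdiff]
  grind

theorem isRainbow_subdivideEdge (hK : IsLowerSet K) (hκ : IsRainbow K κ)
    (ha : {a} ∉ K) (hb : {b} ∉ K) (hab : a ≠ b) (huvK : {u, v} ∈ K)
    (hκa : κ a = κ u) (hκb : κ b = κ v) (huv : κ u ≠ κ v) :
    IsRainbow (stellar (stellar K {u, v} b) {b, v} a) κ := by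
  intro t ht x hx y hy hxy
  obtain ⟨-, huat, hbvt, ht | ⟨hab', ht⟩⟩ :=
    (mem_subdivideEdge hK ha hb hab huvK (ne_of_apply_ne κ huv)).mp ht
  · exact hκ t ht hx hy hxy
  · have := hκ.eq ht
    simp only [Finset.mem_coe] at hx hy
    grind

theorem hasAlternatingPath_subdivideEdge (hK : IsLowerSet K)
    (ha : {a} ∉ K) (hb : {b} ∉ K) (hab : a ≠ b) (huvw : {u, v, w} ∈ K)
    (hκa : κ a = κ u) (hκb : κ b = κ v) (huv : κ u ≠ κ v) (hwu : κ w ≠ κ u) (hwv : κ w ≠ κ v) :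
    HasAlternatingPath (stellar (stellar K {u, v} b) {b, v} a) κ w u b a v := by
  have huv' : {u, v} ∈ K := hK (by grind) huvw
  have hmem := fun t => mem_subdivideEdge (t := t) hK ha hb hab huv' (ne_of_apply_ne κ huv)
  have hauvw := notMem_of_singleton_notMem hK ha huvw
  have hbuvw := notMem_of_singleton_notMem hK hb huvw
  have ha' := fun t => notMem_of_singleton_notMem (t := t) hK ha
  have hb' := fun t => notMem_of_singleton_notMem (t := t) hK hb
  exact {
    mem := (hmem _).mpr ⟨by grind, by grind, by grind, Or.inr ⟨by simp, hK (by grind) huvw⟩⟩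
    ends := fun h => ((hmem _).mp h).1 (by simp)
    color_pr := hκa.symm
    color_qs := hκb
    ne_wq := hκb ▸ hwv
    ne_wr := hκa ▸ hwu
    ne_qr := hκa ▸ hκb ▸ huv.symm
    ne_pr := by grind
    ne_qs := by grind
    link_q := by
      intro t ht _ hbt hut hat
      obtain ⟨-, -, hbv, ht | ⟨-, ht⟩⟩ := (hmem _).mp ht
      · exact absurd hbt (hb' t ht)
      · exact ⟨(hmem _).mpr ⟨by grind, by grind, by grind, Or.inr ⟨by grind, hK (by grind) ht⟩⟩,
          (hmem _).mpr ⟨by grind, by grind, by grind, Or.inr ⟨by grind, hK (by grind) ht⟩⟩⟩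
    link_r := by
      intro t ht _ hat hbt hvt
      obtain ⟨-, hua, -, ht | ⟨-, ht⟩⟩ := (hmem _).mp ht
      · exact absurd hat (ha' t ht)
      · exact ⟨(hmem _).mpr ⟨by grind, by grind, by grind, Or.inr ⟨by grind, hK (by grind) ht⟩⟩,
          (hmem _).mpr ⟨by grind, by grind, by grind, Or.inr ⟨by grind, hK (by grind) ht⟩⟩⟩ }

end SubdivideEdge

section PathMove

variable {V C : Type*} [DecidableEq V] {K : Set (Finset V)} {κ : V → C} {w p q r s z : V}
  {t : Finset V}

/-- The retriangulation of the disc with boundary `w p q r s` that replaces the triangles `w p q`,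
`w q r`, `w r s` by `w p s` and the four triangles of the cone from a new vertex `z` over the
cycle `p q r s`. -/
def pathMove (K : Set (Finset V)) (w p q r s z : V) : Set (Finset V) :=
  stellar (bistellar (bistellar K {w, q} {p, r}) {w, r} {p, s}) {p, r} z

namespace HasAlternatingPath

theorem pairwise_ne (h : HasAlternatingPath K κ w p q r s) :
    w ≠ p ∧ w ≠ q ∧ w ≠ r ∧ w ≠ s ∧ p ≠ q ∧ p ≠ r ∧ p ≠ s ∧ q ≠ r ∧ q ≠ s ∧ r ≠ s := by
  obtain ⟨-, -, hpr, hqs, hwq, hwr, hqr, hpr', hqs', -, -⟩ := h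
  refine ⟨?_, ?_, ?_, ?_, ?_, hpr', ?_, ?_, hqs', ?_⟩ <;> rintro rfl <;> simp_all only [ne_eq,
    not_true_eq_false]

theorem mem_pwq (h : HasAlternatingPath K κ w p q r s) (hK : IsLowerSet K) :
    {p, w, q} ∈ K := by
  have := h.pairwise_ne
  exact (h.link_q {w, q} (hK (by grind) h.mem) (by simp) (by simp) (by grind) (by grind)).1

theorem isFlippable_first (h : HasAlternatingPath K κ w p q r s) (hκ : IsRainbow K κ) :
    IsFlippable K {w, q} {p, r} where
  nonempty_left := by simp
  nonempty_right := by simp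
  disjoint := by
    have := h.pairwise_ne
    simp [*, Ne.symm]
  notMem hpr := h.ne_pr (hκ.eq hpr p (by simp) r (by simp) h.color_pr)
  union_mem t ht hwq hdisj b hb := by
    rw [Finset.disjoint_insert_right, Finset.disjoint_singleton_right] at hdisj
    obtain ⟨hpt, hrt⟩ := h.link_q t ht (hwq (by simp)) (hwq (by simp)) hdisj.1 hdisj.2
    have := h.ne_pr
    obtain rfl | rfl : b = p ∨ b = r := by simpa using hb
    · convert hrt using 1
      grind
    · convert hpt using 1
      grind

theorem isLowerSet_first (h : HasAlternatingPath K κ w p q r s) (hK : IsLowerSet K)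
    (hκ : IsRainbow K κ) : IsLowerSet (bistellar K {w, q} {p, r}) :=
  (h.isFlippable_first hκ).isLowerSet_bistellar hK

theorem isFlippable_second (h : HasAlternatingPath K κ w p q r s) (hK : IsLowerSet K)
    (hκ : IsRainbow K κ) : IsFlippable (bistellar K {w, q} {p, r}) {w, r} {p, s} where
  nonempty_left := by simp
  nonempty_right := by simp
  disjoint := by
    have := h.pairwise_ne
    simp [*, Ne.symm]
  notMem hps := by
    obtain ⟨-, hps | ⟨-, hqs⟩⟩ := mem_bistellar_pair.mp hps
    · exact h.ends hps
    · have := h.pairwise_ne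
      exact h.ne_qs (hκ.eq hqs q (by simp) s (by grind) h.color_qs)
  union_mem t ht hwr hdisj b hb := by
    have := h.pairwise_ne
    rw [Finset.disjoint_insert_right, Finset.disjoint_singleton_right] at hdisj
    rw [Finset.insert_subset_iff, Finset.singleton_subset_iff] at hwr
    rw [mem_bistellar_pair] at ht ⊢
    obtain ⟨hwq, ht | ⟨⟨hpt, -⟩, -⟩⟩ := ht
    · obtain ⟨hqt, hst⟩ := h.link_r t ht hwr.1 hwr.2 (fun hq => hwq ⟨hwr.1, hq⟩) hdisj.2
      refine ⟨by grind, ?_⟩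
      obtain rfl | rfl : b = p ∨ b = s := by simpa using hb
      · exact Or.inl (hK (by grind) hst)
      · exact Or.inr ⟨by grind, hK (by grind) hqt⟩
    · exact absurd hpt hdisj.1

theorem isLowerSet_second (h : HasAlternatingPath K κ w p q r s) (hK : IsLowerSet K)
    (hκ : IsRainbow K κ) :
    IsLowerSet (bistellar (bistellar K {w, q} {p, r}) {w, r} {p, s}) :=
  (h.isFlippable_second hK hκ).isLowerSet_bistellar (h.isLowerSet_first hK hκ)

theorem new_ne (h : HasAlternatingPath K κ w p q r s) (hK : IsLowerSet K) (hz : {z} ∉ K) :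
    z ≠ w ∧ z ≠ p ∧ z ≠ q ∧ z ≠ r := by
  have hwqr := notMem_of_singleton_notMem hK hz h.mem
  have hpwq := notMem_of_singleton_notMem hK hz (h.mem_pwq hK)
  grind

theorem isFlippable_third (h : HasAlternatingPath K κ w p q r s) (hK : IsLowerSet K)
    (hz : {z} ∉ K) :
    IsFlippable (bistellar (bistellar K {w, q} {p, r}) {w, r} {p, s}) {p, r} {z} := by
  have := h.pairwise_ne
  have := h.new_ne hK hz
  refine isFlippable_singleton (by simp) (by grind) fun hm => ?_
  rw [mem_bistellar_pair, mem_bistellar_pair] at hm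
  grind

theorem isLowerSet_pathMove (h : HasAlternatingPath K κ w p q r s) (hK : IsLowerSet K)
    (hκ : IsRainbow K κ) (hz : {z} ∉ K) : IsLowerSet (pathMove K w p q r s z) :=
  (h.isFlippable_third hK hz).isLowerSet_bistellar (h.isLowerSet_second hK hκ)

theorem nonempty_homeomorph_pathMove [Fintype V] (h : HasAlternatingPath K κ w p q r s)
    (hK : IsLowerSet K) (hκ : IsRainbow K κ) (hz : {z} ∉ K) :
    Nonempty (polyhedron K ≃ₜ polyhedron (pathMove K w p q r s z)) := by
  obtain ⟨e₁⟩ := (h.isFlippable_first hκ).nonempty_homeomorph hK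
  obtain ⟨e₂⟩ := (h.isFlippable_second hK hκ).nonempty_homeomorph (h.isLowerSet_first hK hκ)
  obtain ⟨e₃⟩ := (h.isFlippable_third hK hz).nonempty_homeomorph (h.isLowerSet_second hK hκ)
  exact ⟨(e₁.trans e₂).trans e₃⟩

theorem mem_pathMove (h : HasAlternatingPath K κ w p q r s) (hκ : IsRainbow K κ)
    (ht : t ∈ K) (hwt : w ∉ t) : t ∈ pathMove K w p q r s z := by
  refine mem_stellar_pair.mpr ⟨fun hpr => ?_, Or.inl (mem_bistellar_pair.mpr
    ⟨fun h => hwt h.1, Or.inl (mem_bistellar_pair.mpr ⟨fun h => hwt h.1, Or.inl ht⟩)⟩)⟩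
  exact h.ne_pr (hκ.eq ht p hpr.1 r hpr.2 h.color_pr)

theorem singleton_mem_pathMove (h : HasAlternatingPath K κ w p q r s) {v : V} (hv : {v} ∈ K) :
    {v} ∈ pathMove K w p q r s z := by
  have := h.pairwise_ne
  exact singleton_mem_stellar_pair h.ne_pr (mem_bistellar_pair.mpr
    ⟨by grind, Or.inl (mem_bistellar_pair.mpr ⟨by grind, Or.inl hv⟩)⟩)

theorem singleton_new_mem_pathMove (h : HasAlternatingPath K κ w p q r s) (hK : IsLowerSet K)
    (hz : {z} ∉ K) : {z} ∈ pathMove K w p q r s z := by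
  have := h.pairwise_ne
  have := h.new_ne hK hz
  refine singleton_new_mem_stellar (by simp) (mem_bistellar_pair.mpr ⟨by grind, Or.inl
    (mem_bistellar_pair.mpr ⟨by grind, Or.inr ⟨by simp, hK ?_ h.mem⟩⟩)⟩) (by grind)
  grind

/-- Exchanging `p` for the equally coloured vertex `r` turns the new faces into faces of `K`. -/
theorem mem_or_insert_erase_mem (h : HasAlternatingPath K κ w p q r s) (hK : IsLowerSet K)
    (ht : t ∈ bistellar (bistellar K {w, q} {p, r}) {w, r} {p, s}) :
    t ∈ K ∨ p ∈ t ∧ insert w (insert r (t.erase p)) ∈ K := by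
  have := h.pairwise_ne
  rw [mem_bistellar_pair, mem_bistellar_pair] at ht
  obtain ⟨-, ⟨-, ht | ⟨hpr, ht⟩⟩ | ⟨hps, ht⟩⟩ := ht
  · exact Or.inl ht
  · have hr := (h.link_q _ ht (by grind) (by grind) (by grind) (by grind)).2
    exact Or.inr ⟨hpr.1, hK (by grind) hr⟩
  · obtain ⟨hwq, ht | ⟨hpr, -⟩⟩ := mem_bistellar_pair.mp ht
    · have hs := (h.link_r _ ht (by grind) (by grind) (by grind) (by grind)).2
      exact Or.inr ⟨hps.1, hK (by grind) hs⟩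
    · grind

theorem isRainbow_pathMove (h : HasAlternatingPath K κ w p q r s) (hK : IsLowerSet K)
    (hκ : IsRainbow K κ) (hz : {z} ∉ K) (hκz : κ z = κ w) :
    IsRainbow (pathMove K w p q r s z) κ := by
  have hpr := h.color_pr
  intro t ht x hx y hy hxy
  simp only [Finset.mem_coe] at hx hy
  obtain ⟨hprt, ht | ⟨-, ht⟩⟩ := mem_stellar_pair.mp ht
  · obtain ht | ⟨hpt, ht⟩ := h.mem_or_insert_erase_mem hK ht
    · exact hκ.eq ht x hx y hy hxy
    · have := hκ.eq ht
      grind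
  · have hwt : w ∉ t := by
      have := ht.1
      have := h.pairwise_ne
      have := h.new_ne hK hz
      grind
    obtain ht | ⟨-, ht⟩ := h.mem_or_insert_erase_mem hK ht
    · exact absurd (hκ.eq ht p (by simp) r (by simp) hpr) h.ne_pr
    · obtain ⟨T, hT, hwT, hrT, htT⟩ :
          ∃ T ∈ K, w ∈ T ∧ r ∈ T ∧ ∀ x ∈ t, x = z ∨ x = p ∨ x ∈ T :=
        ⟨_, ht, by simp, by simp, by grind⟩
      have := hκ.eq hT
      have := h.ne_wr
      have := htT x hx
      have := htT y hy
      grind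

end HasAlternatingPath

end PathMove

section Twisted

variable {V C : Type*} [DecidableEq V]

/-- The edge `x z` of `K` has two ends of the same colour; its link avoids the colour of the second
such edge `x' z'`, and `x` and `z'` are the only neighbours of `z` with their colours around the
edge `w z`. -/
structure IsDefectEdge (K : Set (Finset V)) (κ : V → C) (w x z x' z' : V) : Prop where
  edge : {x, z} ∈ K
  ne : x ≠ z
  nonedge : ∀ t ∈ K, x ∈ t → z' ∉ t
  link_edge : ∀ t ∈ K, x ∈ t → z ∈ t → ∀ y ∈ t, κ y ≠ κ x'
  link : ∀ t ∈ K, w ∈ t → z ∈ t → (z' ∉ t → insert x t ∈ K) ∧ (x ∉ t → insert z' t ∈ K)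
  color : κ x = κ z
  ne_color : κ w ≠ κ z

/-- A complex that is rainbow up to the two edges `x₁ z₁` and `x₂ z₂`, which span an empty
quadrangle `x₁ x₂ z₂ z₁` whose diagonals are missing. -/
structure IsTwistedRainbow (K : Set (Finset V)) (κ : V → C) (w x₁ z₁ x₂ z₂ : V) : Prop where
  mem : {w, z₁, z₂} ∈ K
  ne_color : κ z₁ ≠ κ z₂
  rainbow : ∀ t ∈ K, ∀ x ∈ t, ∀ y ∈ t, κ x = κ y → x = y ∨
    (x = x₁ ∧ y = z₁) ∨ (x = z₁ ∧ y = x₁) ∨ (x = x₂ ∧ y = z₂) ∨ (x = z₂ ∧ y = x₂)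
  defect₁ : IsDefectEdge K κ w x₁ z₁ x₂ z₂
  defect₂ : IsDefectEdge K κ w x₂ z₂ x₁ z₁

variable {K : Set (Finset V)} {κ : V → C} {w x z x' z' x₁ z₁ x₂ z₂ u v : V} {t : Finset V}

theorem IsDefectEdge.mapFaces {W : Type*} [DecidableEq W] (h : IsDefectEdge K κ w x z x' z')
    (f : V ↪ W) {κ' : W → C} (hκ : ∀ v, κ' (f v) = κ v) :
    IsDefectEdge (mapFaces f K) κ' (f w) (f x) (f z) (f x') (f z') where
  edge := ⟨_, h.edge, by simp⟩
  ne := f.injective.ne h.ne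
  color := by simpa only [hκ] using h.color
  ne_color := by simpa only [hκ] using h.ne_color
  nonedge := by
    rintro _ ⟨t, ht, rfl⟩ hxt
    simpa using h.nonedge t ht (by simpa using hxt)
  link_edge := by
    rintro _ ⟨t, ht, rfl⟩ hxt hzt _ hy
    obtain ⟨y, hyt, rfl⟩ := Finset.mem_map.mp hy
    simpa only [hκ] using h.link_edge t ht (by simpa using hxt) (by simpa using hzt) y hyt
  link := by
    rintro _ ⟨t, ht, rfl⟩ hwt hzt
    obtain ⟨hx, hz'⟩ := h.link t ht (by simpa using hwt) (by simpa using hzt)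
    exact ⟨fun hz't => ⟨_, hx (by simpa using hz't), by simp⟩,
      fun hxt => ⟨_, hz' (by simpa using hxt), by simp⟩⟩

theorem IsTwistedRainbow.mapFaces {W : Type*} [DecidableEq W]
    (h : IsTwistedRainbow K κ w x₁ z₁ x₂ z₂) (f : V ↪ W) {κ' : W → C}
    (hκ : ∀ v, κ' (f v) = κ v) :
    IsTwistedRainbow (mapFaces f K) κ' (f w) (f x₁) (f z₁) (f x₂) (f z₂) where
  mem := ⟨_, h.mem, by simp⟩
  ne_color := by simpa only [hκ] using h.ne_color
  rainbow := by
    rintro _ ⟨t, ht, rfl⟩ _ hx _ hy hxy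
    obtain ⟨x, hxt, rfl⟩ := Finset.mem_map.mp hx
    obtain ⟨y, hyt, rfl⟩ := Finset.mem_map.mp hy
    simpa using h.rainbow t ht x hxt y hyt (by simpa only [hκ] using hxy)
  defect₁ := h.defect₁.mapFaces f hκ
  defect₂ := h.defect₂.mapFaces f hκ

namespace IsTwistedRainbow

theorem symm (h : IsTwistedRainbow K κ w x₁ z₁ x₂ z₂) : IsTwistedRainbow K κ w x₂ z₂ x₁ z₁ where
  mem := Finset.pair_comm z₁ z₂ ▸ h.mem
  ne_color := h.ne_color.symm
  rainbow t ht x hx y hy hxy := by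
    have := h.rainbow t ht x hx y hy hxy
    tauto
  defect₁ := h.defect₂
  defect₂ := h.defect₁

theorem edge_mem_stellar (h : IsTwistedRainbow K κ w x₁ z₁ x₂ z₂) :
    {x₂, z₂} ∈ stellar K {x₁, z₁} u :=
  mem_stellar_pair.mpr ⟨fun hx => h.defect₁.nonedge _ h.defect₂.edge hx.1 (by simp),
    Or.inl h.defect₂.edge⟩

theorem mem_stellar_stellar (h : IsTwistedRainbow K κ w x₁ z₁ x₂ z₂) (hK : IsLowerSet K)
    (hu : {u} ∉ K) (hv : {v} ∉ K) :
    t ∈ stellar (stellar K {x₁, z₁} u) {x₂, z₂} v ↔ ¬(x₁ ∈ t ∧ z₁ ∈ t) ∧ ¬(x₂ ∈ t ∧ z₂ ∈ t) ∧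
      (t ∈ K ∨ (u ∈ t ∧ t \ {u} ∪ {x₁, z₁} ∈ K) ∨ v ∈ t ∧ t \ {v} ∪ {x₂, z₂} ∈ K) := by
  have hu₂ := notMem_of_singleton_notMem hK hu h.defect₂.edge
  have hv₁ := notMem_of_singleton_notMem hK hv h.defect₁.edge
  have h₂ := h.defect₂.nonedge (t \ {v} ∪ {x₂, z₂})
  have h₂' := h.defect₂.nonedge ((t \ {v} ∪ {x₂, z₂}) \ {u} ∪ {x₁, z₁})
  simp only [mem_stellar_pair]
  grind

theorem stellar_stellar_comm (h : IsTwistedRainbow K κ w x₁ z₁ x₂ z₂) (hK : IsLowerSet K)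
    (hu : {u} ∉ K) (hv : {v} ∉ K) :
    stellar (stellar K {x₁, z₁} u) {x₂, z₂} v = stellar (stellar K {x₂, z₂} v) {x₁, z₁} u := by
  ext t
  rw [h.mem_stellar_stellar hK hu hv, h.symm.mem_stellar_stellar hK hv hu]
  tauto

/-- A face through the new vertex `u` is rainbow, since `u` fills in the colour missing in the link
of the edge `x₁ z₁`. -/
theorem injOn_of_subdivided (h : IsTwistedRainbow K κ w x₁ z₁ x₂ z₂) (hκu : κ u = κ x₂)
    (hxz : ¬(x₁ ∈ t ∧ z₁ ∈ t)) (ht : t \ {u} ∪ {x₁, z₁} ∈ K) : Set.InjOn κ t := by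
  have hrainbow := h.rainbow _ ht
  have hlink := h.defect₁.link_edge _ ht (by simp) (by simp)
  have hz₂ := h.defect₁.nonedge _ ht (by simp)
  have hmem : ∀ x ∈ t, x = u ∨ x ∈ t \ {u} ∪ {x₁, z₁} := by grind
  intro x hx y hy hxy
  have hx' := hmem x hx
  have hy' := hmem y hy
  simp only [Finset.mem_coe] at hx hy
  grind

theorem isRainbow (h : IsTwistedRainbow K κ w x₁ z₁ x₂ z₂) (hK : IsLowerSet K)
    (hu : {u} ∉ K) (hv : {v} ∉ K) (hκu : κ u = κ x₂) (hκv : κ v = κ x₁) :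
    IsRainbow (stellar (stellar K {x₁, z₁} u) {x₂, z₂} v) κ := by
  intro t ht
  obtain ⟨h₁, h₂, ht | ⟨-, ht⟩ | ⟨-, ht⟩⟩ := (h.mem_stellar_stellar hK hu hv).mp ht
  · intro x hx y hy hxy
    have := h.rainbow t ht x hx y hy hxy
    simp only [Finset.mem_coe] at hx hy
    grind
  · exact h.injOn_of_subdivided hκu h₁ ht
  · exact h.symm.injOn_of_subdivided hκv h₂ ht

theorem insert_mem_stellar_stellar (h : IsTwistedRainbow K κ w x₁ z₁ x₂ z₂) (hK : IsLowerSet K)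
    (hu : {u} ∉ K) (hv : {v} ∉ K)
    (ht : t ∈ stellar (stellar K {x₁, z₁} u) {x₂, z₂} v) (hwt : w ∈ t) (hz₁ : z₁ ∈ t)
    (hz₂ : z₂ ∉ t) (hut : u ∉ t) :
    insert u t ∈ stellar (stellar K {x₁, z₁} u) {x₂, z₂} v ∧
      insert z₂ t ∈ stellar (stellar K {x₁, z₁} u) {x₂, z₂} v := by
  have hmem := fun t => h.mem_stellar_stellar (t := t) (v := v) hK hu hv
  have hu₁ := notMem_of_singleton_notMem hK hu h.defect₁.edge
  have hxz₁₂ := h.defect₁.nonedge _ h.defect₁.edge (by simp)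
  obtain ⟨hxz₁, -, ht | ⟨hut', -⟩ | ⟨-, ht⟩⟩ := (hmem t).mp ht
  · obtain ⟨hx₁t, hz₂t⟩ := h.defect₁.link t ht hwt hz₁
    have hx₂t : x₂ ∉ t := fun hx₂t => h.defect₂.nonedge t ht hx₂t hz₁
    have hne₂ := h.defect₂.ne
    rw [hmem, hmem]
    refine ⟨⟨?_, ?_, Or.inr (Or.inl ⟨by simp, hK ?_ (hx₁t hz₂)⟩)⟩,
      ?_, ?_, Or.inl (hz₂t fun hx₁ => hxz₁ ⟨hx₁, hz₁⟩)⟩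
    all_goals clear hmem; grind
  · exact absurd hut' hut
  · have hv₁ := notMem_of_singleton_notMem hK hv h.defect₁.edge
    exact absurd (by grind) (h.defect₂.nonedge _ ht (by simp))

theorem hasAlternatingPath (h : IsTwistedRainbow K κ w x₁ z₁ x₂ z₂)
    (hK : IsLowerSet K) (hu : {u} ∉ K) (hv : {v} ∉ K) (huv : u ≠ v) (hκu : κ u = κ x₂)
    (hκv : κ v = κ x₁) :
    HasAlternatingPath (stellar (stellar K {x₁, z₁} u) {x₂, z₂} v) κ w v z₂ z₁ u where
  mem := by
    have hmem : {w, z₂, z₁} ∈ K := Finset.pair_comm z₁ z₂ ▸ h.mem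
    exact (h.mem_stellar_stellar hK hu hv).mpr
      ⟨fun hx => h.defect₁.nonedge _ hmem hx.1 (by simp),
        fun hx => h.defect₂.nonedge _ hmem hx.1 (by simp), Or.inl hmem⟩
  ends hvu := by
    have hu' := fun t => notMem_of_singleton_notMem (t := t) hK hu
    have hv' := fun t => notMem_of_singleton_notMem (t := t) hK hv
    obtain ⟨-, -, ht | ⟨-, ht⟩ | ⟨-, ht⟩⟩ := (h.mem_stellar_stellar hK hu hv).mp hvu
    · exact hu' _ ht (by simp)
    · exact hv' _ ht (by simp [huv.symm])
    · exact hu' _ ht (by simp [huv])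
  color_pr := hκv.trans h.defect₁.color
  color_qs := (hκu.trans h.defect₂.color).symm
  ne_wq := h.defect₂.ne_color
  ne_wr := h.defect₁.ne_color
  ne_qr := h.ne_color.symm
  ne_pr := by
    have := notMem_of_singleton_notMem hK hv h.mem
    grind
  ne_qs := by
    have := notMem_of_singleton_notMem hK hu h.mem
    grind
  link_q t ht hwt hz₂ hvt hz₁ := by
    rw [h.stellar_stellar_comm hK hu hv] at ht ⊢
    exact h.symm.insert_mem_stellar_stellar hK hv hu ht hwt hz₂ hz₁ hvt
  link_r t ht hwt hz₁ hz₂ hut :=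
    (h.insert_mem_stellar_stellar hK hu hv ht hwt hz₁ hz₂ hut).symm

end IsTwistedRainbow

end Twisted

section CrossTorusColors

variable {d : ℕ} {σ : Equiv.Perm (Fin d)} {t : Finset (Fin 3 × Fin d)}

theorem isCylinderFace_two_iff :
    IsCylinderFace σ 2 t ↔ (∀ p ∈ t, p.1 = 2 ∨ p.1 = 0) ∧ (∀ i, (2, i) ∈ t → (0, σ i) ∉ t) ∧
      (∃ i, (2, i) ∉ t) ∧ ∃ i, (0, i) ∉ t :=
  ⟨fun h => ⟨h.level, h.antipodal, h.lower, h.upper⟩, fun h => ⟨h.1, h.2.1, h.2.2.1, h.2.2.2⟩⟩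

theorem isCylinderFace_two_of_mem (ht : t ∈ crossTorus σ) {i j : Fin d} (hi : (0, i) ∈ t)
    (hj : (2, j) ∈ t) : IsCylinderFace σ 2 t := by
  obtain ⟨c, h⟩ := ht
  have hci := h.level _ hi
  have hcj := h.level _ hj
  fin_cases c
  · simp at hcj
  · simp at hci
  · exact h

theorem singleton_mem_crossTorus {m : ℕ} (σ : Equiv.Perm (Fin (m + 2)))
    (v : Fin 3 × Fin (m + 2)) : {v} ∈ crossTorus σ := by
  obtain ⟨c, i⟩ := v
  obtain ⟨j, hj⟩ := exists_ne i
  exact ⟨c, fun p hp => Or.inl (by rw [Finset.mem_singleton.mp hp]), by simp,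
    ⟨j, by simp [hj]⟩, ⟨i, by simp⟩⟩

theorem image_mem_crossTorus {f : Fin d → Fin 3} (hf : ∀ i, f i = 0 ∨ f i = 1) {i j : Fin d}
    (hi : f i = 0) (hj : f j = 1) : Finset.univ.image (fun i => (f i, i)) ∈ crossTorus σ := by
  refine ⟨0, fun p hp => ?_, fun k hk hk' => ?_, ⟨j, by simp [hj]⟩, ⟨i, by simp [hi]⟩⟩
  · obtain ⟨k, -, rfl⟩ := Finset.mem_image.mp hp
    exact hf k
  · have hk₀ : f k = 0 := by simpa using hk
    have hk₁ : f k = 1 := by simpa [glue] using hk'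
    exact zero_ne_one (hk₀.symm.trans hk₁)

theorem hasDisjointFacets_crossTorus {m : ℕ} (σ : Equiv.Perm (Fin (m + 2))) :
    HasDisjointFacets (crossTorus σ) (m + 2) := by
  have hcard : ∀ f : Fin (m + 2) → Fin 3,
      (Finset.univ.image (fun i => (f i, i))).card = m + 2 := by
    intro f
    rw [Finset.card_image_of_injective _ fun i j h => (Prod.mk.inj h).2, Finset.card_univ,
      Fintype.card_fin]
  refine ⟨_, image_mem_crossTorus (f := fun i => if i = 0 then 0 else 1) (i := 0) (j := 1)
      (by grind) (by simp) (by simp), _,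
    image_mem_crossTorus (f := fun i => if i = 0 then 1 else 0) (i := 1) (j := 0)
      (by grind) (by simp) (by simp), ?_, hcard _, hcard _⟩
  rw [Finset.disjoint_left]
  rintro ⟨c, i⟩ hi hi'
  simp only [Finset.mem_image, Finset.mem_univ, true_and, Prod.mk.injEq, exists_eq_right]
    at hi hi'
  grind

theorem level_eq_of_mem_crossTorus (ht : t ∈ crossTorus σ) {a b : Fin 3} {i : Fin d}
    (ha : (a, i) ∈ t) (hb : (b, i) ∈ t) :
    a = b ∨ σ i ≠ i ∧ (a = 0 ∧ b = 2 ∨ a = 2 ∧ b = 0) := by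
  obtain ⟨c, h⟩ := ht
  have hca := h.level _ ha
  have hcb := h.level _ hb
  have hanti := h.antipodal i
  have hglue : glue σ c i = if c = 2 then σ i else i := by
    unfold glue
    split_ifs <;> rfl
  fin_cases c <;> grind

theorem isRainbow_crossTorus (d : ℕ) :
    IsRainbow (crossTorus (1 : Equiv.Perm (Fin d))) Prod.snd := by
  rintro t ht ⟨a, i⟩ ha ⟨b, j⟩ hb (rfl : i = j)
  obtain rfl | ⟨hi, -⟩ := level_eq_of_mem_crossTorus ht ha hb
  · rfl
  · exact absurd rfl hi

variable {i j k : Fin d}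

theorem antipodal_of_mem_crossTorus_swap (ht : t ∈ crossTorus (Equiv.swap i j)) :
    ((2, i) ∈ t → (0, j) ∉ t) ∧ ((2, j) ∈ t → (0, i) ∉ t) := by
  refine ⟨fun h₂ h₀ => ?_, fun h₂ h₀ => ?_⟩ <;>
  · have hanti := (isCylinderFace_two_iff.mp (isCylinderFace_two_of_mem ht h₀ h₂)).2.1 _ h₂
    simp [h₀] at hanti

theorem isDefectEdge_crossTorus (hij : i ≠ j) (hik : i ≠ k) (hjk : j ≠ k) :
    IsDefectEdge (crossTorus (Equiv.swap i j)) Prod.snd (0, k) (0, i) (2, i) (0, j) (2, j) where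
  edge := by
    refine ⟨2, isCylinderFace_two_iff.mpr ⟨by simp, fun l hl => ?_, ⟨j, ?_⟩, ⟨j, ?_⟩⟩⟩
    · obtain rfl : l = i := by simpa using hl
      simpa using hij.symm
    all_goals simpa using hij.symm
  ne := by simp
  color := rfl
  ne_color := hik.symm
  nonedge t ht hi hj := (antipodal_of_mem_crossTorus_swap ht).2 hj hi
  link_edge t ht hi₀ hi₂ := by
    rintro ⟨c, l⟩ hl (rfl : l = j)
    obtain ⟨hanti_i, hanti_j⟩ := antipodal_of_mem_crossTorus_swap ht
    obtain rfl | rfl : c = 2 ∨ c = 0 :=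
      (isCylinderFace_two_iff.mp (isCylinderFace_two_of_mem ht hi₀ hi₂)).1 _ hl
    · exact hanti_j hl hi₀
    · exact hanti_i hi₂ hl
  link t ht hk hi := by
    have hj := (antipodal_of_mem_crossTorus_swap ht).1 hi
    obtain ⟨hlevel, hanti, -, -⟩ := isCylinderFace_two_iff.mp (isCylinderFace_two_of_mem ht hk hi)
    have hk₂ : (2, k) ∉ t := fun hk₂ => by
      simpa [Equiv.swap_apply_of_ne_of_ne hik.symm hjk.symm, hk] using hanti k hk₂
    refine ⟨fun hj₂ => ⟨2, isCylinderFace_two_iff.mpr ⟨by simpa using hlevel, fun l hl => ?_,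
        ⟨j, by simpa using hj₂⟩, ⟨j, by simpa [hij.symm] using hj⟩⟩⟩,
      fun hi₀ => ⟨2, isCylinderFace_two_iff.mpr ⟨by simpa using hlevel, fun l hl => ?_,
        ⟨k, by simpa [hjk.symm] using hk₂⟩, ⟨i, by simpa using hi₀⟩⟩⟩⟩
    · have hl' : (2, l) ∈ t := by simpa using hl
      have hli : Equiv.swap i j l ≠ i := by
        rintro hli
        rw [Equiv.swap_apply_eq_iff, Equiv.swap_apply_left] at hli
        exact hj₂ (hli ▸ hl')
      simpa [hli] using hanti l hl'
    · obtain rfl | hl' : l = j ∨ (2, l) ∈ t := by simpa using hl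
      · simpa using hi₀
      · simpa using hanti l hl'

theorem isTwistedRainbow_crossTorus (hij : i ≠ j) (hik : i ≠ k) (hjk : j ≠ k) :
    IsTwistedRainbow (crossTorus (Equiv.swap i j)) Prod.snd (0, k) (0, i) (2, i) (0, j) (2, j) where
  mem := by
    refine ⟨2, isCylinderFace_two_iff.mpr
      ⟨by simp, fun l hl => ?_, ⟨k, by simp [hik.symm, hjk.symm]⟩, ⟨i, by simp [hik]⟩⟩⟩
    obtain rfl | rfl : l = i ∨ l = j := by simpa using hl
    · simpa using hjk
    · simpa using hik
  ne_color := hij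
  rainbow := by
    rintro t ht ⟨a, l⟩ ha ⟨b, l'⟩ hb (rfl : l = l')
    obtain rfl | ⟨hl, h⟩ := level_eq_of_mem_crossTorus ht ha hb
    · exact Or.inl rfl
    · have : l = i ∨ l = j := by
        by_contra! hne
        exact hl (Equiv.swap_apply_of_ne_of_ne hne.1 hne.2)
      grind
  defect₁ := isDefectEdge_crossTorus hij hik hjk
  defect₂ := Equiv.swap_comm i j ▸ isDefectEdge_crossTorus hij.symm hjk hik

end CrossTorusColors

section MapFaces

variable {V W C : Type*} {K : Set (Finset V)} {κ : V → C} {κ' : W → C}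

theorem IsRainbow.mapFaces (h : IsRainbow K κ) (f : V ↪ W) (hκ : ∀ v, κ' (f v) = κ v) :
    IsRainbow (mapFaces f K) κ' := by
  rintro _ ⟨t, ht, rfl⟩
  rw [Finset.coe_map]
  exact Set.InjOn.image_of_comp fun x hx y hy hxy => h t ht hx hy (by simpa [hκ] using hxy)

theorem HasDisjointFacets.mapFaces {d : ℕ} (h : HasDisjointFacets K d) (f : V ↪ W) :
    HasDisjointFacets (mapFaces f K) d := by
  obtain ⟨s, hs, t, ht, hst, hsd, htd⟩ := h
  exact ⟨_, ⟨s, hs, rfl⟩, _, ⟨t, ht, rfl⟩, (Finset.disjoint_map f).mpr hst,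
    (s.card_map f).trans hsd, (t.card_map f).trans htd⟩

theorem HasAlternatingPath.mapFaces [DecidableEq V] [DecidableEq W] {w p q r s : V}
    (h : HasAlternatingPath K κ w p q r s) (hK : IsLowerSet K) (f : V ↪ W)
    (hκ : ∀ v, κ' (f v) = κ v) :
    HasAlternatingPath (mapFaces f K) κ' (f w) (f p) (f q) (f r) (f s) where
  mem := ⟨_, h.mem, by simp⟩
  ends := by
    rintro ⟨t, ht, hts⟩
    have hps : ({p, s} : Finset V).map f ⊆ t.map f := by simp [hts]
    exact h.ends (hK (Finset.map_subset_map.mp hps) ht)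
  color_pr := by simpa only [hκ] using h.color_pr
  color_qs := by simpa only [hκ] using h.color_qs
  ne_wq := by simpa only [hκ] using h.ne_wq
  ne_wr := by simpa only [hκ] using h.ne_wr
  ne_qr := by simpa only [hκ] using h.ne_qr
  ne_pr := f.injective.ne h.ne_pr
  ne_qs := f.injective.ne h.ne_qs
  link_q := by
    rintro _ ⟨t, ht, rfl⟩ h₁ h₂ h₃ h₄
    obtain ⟨hp, hr⟩ := h.link_q t ht (by simpa using h₁) (by simpa using h₂) (by simpa using h₃)
      (by simpa using h₄)
    exact ⟨⟨_, hp, by simp⟩, ⟨_, hr, by simp⟩⟩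
  link_r := by
    rintro _ ⟨t, ht, rfl⟩ h₁ h₂ h₃ h₄
    obtain ⟨hq, hs⟩ := h.link_r t ht (by simpa using h₁) (by simpa using h₂) (by simpa using h₃)
      (by simpa using h₄)
    exact ⟨⟨_, hq, by simp⟩, ⟨_, hs, by simp⟩⟩

end MapFaces

section Models

variable {d N : ℕ} {X : Type*} [TopologicalSpace X]

/-- A rainbow complex with two disjoint facets, all of whose vertices are used. Of two disjoint
facets at least one survives a path move. -/
structure IsRainbowModel {V : Type*} (K : Set (Finset V)) (κ : V → Fin d) : Prop where
  lower : IsLowerSet K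
  singleton_mem : ∀ v, {v} ∈ K
  rainbow : IsRainbow K κ
  facets : HasDisjointFacets K d

/-- `X` is triangulated by a rainbow model with `N` vertices and `d` colours. -/
def HasRainbowModel (X : Type*) [TopologicalSpace X] (d N : ℕ) : Prop :=
  ∃ (V : Type) (_ : Fintype V) (_ : DecidableEq V) (K : Set (Finset V)) (κ : V → Fin d),
    Fintype.card V = N ∧ IsRainbowModel K κ ∧ Nonempty (polyhedron K ≃ₜ X)

/-- `X` is triangulated by a rainbow model with `N` vertices and `d` colours that admits a path
move. -/
def HasPathModel (X : Type*) [TopologicalSpace X] (d N : ℕ) : Prop :=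
  ∃ (V : Type) (_ : Fintype V) (_ : DecidableEq V) (K : Set (Finset V)) (κ : V → Fin d),
    Fintype.card V = N ∧ IsRainbowModel K κ ∧ Nonempty (polyhedron K ≃ₜ X) ∧
      ∃ w p q r s, HasAlternatingPath K κ w p q r s

/-- `X` has a balanced triangulation with `N` vertices and `d` colours. -/
def HasBalancedTriangulation (X : Type*) [TopologicalSpace X] (d N : ℕ) : Prop :=
  ∃ (V : Type) (_ : Fintype V) (K : Set (Finset V)) (κ : V → Fin d),
    Fintype.card V = N ∧ IsLowerSet K ∧ (∀ v, {v} ∈ K) ∧ IsRainbow K κ ∧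
      (∃ s ∈ K, s.card = d) ∧ Nonempty (polyhedron K ≃ₜ X)

theorem HasPathModel.hasRainbowModel (h : HasPathModel X d N) : HasRainbowModel X d N := by
  obtain ⟨V, i₁, i₂, K, κ, hN, hK, e, -⟩ := h
  exact ⟨V, i₁, i₂, K, κ, hN, hK, e⟩

theorem HasRainbowModel.hasBalancedTriangulation (h : HasRainbowModel X d N) :
    HasBalancedTriangulation X d N := by
  obtain ⟨V, i₁, -, K, κ, hN, hK, e⟩ := h
  obtain ⟨s, hs, -, -, -, hsd, -⟩ := hK.facets
  exact ⟨V, i₁, K, κ, hN, hK.lower, hK.singleton_mem, hK.rainbow, ⟨s, hs, hsd⟩, e⟩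

theorem IsRainbowModel.exists_triangle {V : Type*} [DecidableEq V] {K : Set (Finset V)}
    {κ : V → Fin d} (h : IsRainbowModel K κ) (hd : 3 ≤ d) :
    ∃ u v w, {u, v, w} ∈ K ∧ κ u ≠ κ v ∧ κ w ≠ κ u ∧ κ w ≠ κ v := by
  obtain ⟨s, hs, -, -, -, hsd, -⟩ := h.facets
  obtain ⟨u, v, w, hu, hv, hw, huv, huw, hvw⟩ := Finset.two_lt_card_iff.mp (hd.trans_eq hsd.symm)
  have hκ := h.rainbow.eq hs
  exact ⟨u, v, w, h.lower (by grind) hs, mt (hκ u hu v hv) huv, mt (hκ w hw u hu) huw.symm,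
    mt (hκ w hw v hv) hvw.symm⟩

section Subdivision

variable {V : Type} {K : Set (Finset V)} {x y x' y' : V ⊕ Fin 2}

/-- The complex `K` on an ambient set that has room for two new vertices. -/
abbrev addTwo (K : Set (Finset V)) : Set (Finset (V ⊕ Fin 2)) :=
  mapFaces .inl K

theorem singleton_inr_notMem_addTwo (i : Fin 2) : {.inr i} ∉ addTwo K :=
  singleton_notMem_mapFaces fun _ => Sum.inl_ne_inr

theorem inr_notMem_of_mem_addTwo (hK : IsLowerSet K) {s : Finset (V ⊕ Fin 2)}
    (hs : s ∈ addTwo K) (i : Fin 2) : .inr i ∉ s :=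
  notMem_of_singleton_notMem (isLowerSet_mapFaces _ hK) (singleton_inr_notMem_addTwo i) hs

variable [DecidableEq V]

/-- The stellar subdivision of two edges, one after the other, with new vertices. -/
abbrev subdivideTwice (K : Set (Finset V)) (x y x' y' : V ⊕ Fin 2) : Set (Finset (V ⊕ Fin 2)) :=
  stellar (stellar (addTwo K) {x, y} (.inr 0)) {x', y'} (.inr 1)

theorem isFlippable_addTwo (hK : IsLowerSet K) (hxy : {x, y} ∈ addTwo K) :
    IsFlippable (addTwo K) {x, y} {.inr 0} :=
  isFlippable_singleton (by simp) (inr_notMem_of_mem_addTwo hK hxy 0)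
    (singleton_inr_notMem_addTwo 0)

theorem isFlippable_stellar_addTwo (hK : IsLowerSet K) (hxy : {x, y} ∈ addTwo K)
    (hxy' : {x', y'} ∈ stellar (addTwo K) {x, y} (.inr 0)) :
    IsFlippable (stellar (addTwo K) {x, y} (.inr 0)) {x', y'} {.inr 1} := by
  have hnew : {.inr 1} ∉ stellar (addTwo K) {x, y} (.inr 0) := by
    rw [mem_stellar_pair]
    rintro ⟨-, h | ⟨h, -⟩⟩
    · exact singleton_inr_notMem_addTwo 1 h
    · simp at h
  exact isFlippable_singleton (by simp) (notMem_of_singleton_notMem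
    ((isFlippable_addTwo hK hxy).isLowerSet_bistellar (isLowerSet_mapFaces _ hK)) hnew hxy') hnew

theorem nonempty_homeomorph_subdivideTwice [Fintype V] (hK : IsLowerSet K)
    (hxy : {x, y} ∈ addTwo K)
    (hxy' : {x', y'} ∈ stellar (addTwo K) {x, y} (.inr 0)) :
    Nonempty (polyhedron K ≃ₜ polyhedron (subdivideTwice K x y x' y')) := by
  have hL : IsLowerSet (addTwo K) := isLowerSet_mapFaces .inl hK
  have hflip := isFlippable_addTwo hK hxy
  obtain ⟨e⟩ := nonempty_homeomorph_mapFaces (.inl : V ↪ V ⊕ Fin 2) K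
  obtain ⟨e₁⟩ := hflip.nonempty_homeomorph hL
  obtain ⟨e₂⟩ := (isFlippable_stellar_addTwo hK hxy hxy').nonempty_homeomorph
    (hflip.isLowerSet_bistellar hL)
  exact ⟨(e.trans e₁).trans e₂⟩

theorem isRainbowModel_subdivideTwice {κ : V ⊕ Fin 2 → Fin d} (hK : IsLowerSet K)
    (hv : ∀ v, {v} ∈ K) (hf : HasDisjointFacets K d) (hxy : {x, y} ∈ addTwo K)
    (hxy' : {x', y'} ∈ stellar (addTwo K) {x, y} (.inr 0)) (hne : x ≠ y) (hne' : x' ≠ y')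
    (hκ : IsRainbow (subdivideTwice K x y x' y') κ) :
    IsRainbowModel (subdivideTwice K x y x' y') κ := by
  have hL : IsLowerSet (addTwo K) := isLowerSet_mapFaces .inl hK
  have hflip := isFlippable_addTwo hK hxy
  have hflip' := isFlippable_stellar_addTwo hK hxy hxy'
  have hL' := hflip.isLowerSet_bistellar hL
  have hb := Finset.disjoint_singleton_right.mp hflip.disjoint
  have ha := Finset.disjoint_singleton_right.mp hflip'.disjoint
  refine ⟨hflip'.isLowerSet_bistellar hL', ?_, hκ,
    ((hf.mapFaces .inl).stellar hL hflip.notMem (by simp) hb).stellar hL' hflip'.notMem (by simp)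
      ha⟩
  rintro (v | i)
  · exact singleton_mem_stellar_pair hne' (singleton_mem_stellar_pair hne
      (singleton_mem_mapFaces (hv v)))
  · fin_cases i
    · exact singleton_mem_stellar_pair hne' (singleton_new_mem_stellar (by simp) hxy hb)
    · exact singleton_new_mem_stellar (by simp) hxy' ha

end Subdivision

theorem HasRainbowModel.hasPathModel (h : HasRainbowModel X d N) (hd : 3 ≤ d) :
    HasPathModel X d (N + 2) := by
  obtain ⟨V, _, _, K, κ, hN, hK, ⟨e⟩⟩ := h
  obtain ⟨u, v, w, huvw, huv, hwu, hwv⟩ := hK.exists_triangle hd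
  have huvK : {u, v} ∈ K := hK.lower (by grind) huvw
  let κ' : V ⊕ Fin 2 → Fin d := Sum.elim κ ![κ v, κ u]
  have hL : IsLowerSet (addTwo K) := isLowerSet_mapFaces _ hK.lower
  have ha := singleton_inr_notMem_addTwo (K := K) 1
  have hb := singleton_inr_notMem_addTwo (K := K) 0
  have huvL : {.inl u, .inl v} ∈ addTwo K := ⟨_, huvK, by simp⟩
  have huv' : (.inl u : V ⊕ Fin 2) ≠ .inl v := Sum.inl_injective.ne (ne_of_apply_ne κ huv)
  have hbv : {.inr 0, .inl v} ∈ stellar (addTwo K) {.inl u, .inl v} (.inr 0) :=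
    mem_stellar_pair.mpr ⟨by grind, Or.inr ⟨by simp, hL (fun x hx => by grind) huvL⟩⟩
  have hrainbow := isRainbow_subdivideEdge (κ := κ') hL (hK.rainbow.mapFaces _ fun _ => rfl)
    ha hb (by simp) huvL rfl rfl huv
  have hpath := hasAlternatingPath_subdivideEdge (κ := κ') (u := .inl u) (v := .inl v)
    (w := .inl w) hL ha hb (by simp) ⟨_, huvw, by simp⟩ rfl rfl huv hwu hwv
  obtain ⟨e'⟩ := nonempty_homeomorph_subdivideTwice hK.lower huvL hbv
  exact ⟨_, inferInstance, inferInstance, _, κ', by simp [hN], isRainbowModel_subdivideTwice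
    hK.lower hK.singleton_mem hK.facets huvL hbv huv' Sum.inr_ne_inl hrainbow,
    ⟨e'.symm.trans e⟩, _, _, _, _, _, hpath⟩

theorem HasPathModel.hasBalancedTriangulation_succ (h : HasPathModel X d N) :
    HasBalancedTriangulation X d (N + 1) := by
  obtain ⟨V, _, _, K, κ, hN, hK, ⟨e⟩, w, p, q, r, s, hpath⟩ := h
  let κ' : V ⊕ Unit → Fin d := Sum.elim κ fun _ => κ w
  have hL := isLowerSet_mapFaces (.inl : V ↪ V ⊕ Unit) hK.lower
  have hz : {.inr ()} ∉ mapFaces (.inl : V ↪ V ⊕ Unit) K :=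
    singleton_notMem_mapFaces fun _ => Sum.inl_ne_inr
  have hrainbow := hK.rainbow.mapFaces (κ' := κ') .inl fun _ => rfl
  have hpath' := hpath.mapFaces (κ' := κ') hK.lower .inl fun _ => rfl
  obtain ⟨e₁⟩ := nonempty_homeomorph_mapFaces (.inl : V ↪ V ⊕ Unit) K
  obtain ⟨e₂⟩ := hpath'.nonempty_homeomorph_pathMove hL hrainbow hz
  refine ⟨V ⊕ Unit, inferInstance, _, κ', by simp [hN],
    hpath'.isLowerSet_pathMove hL hrainbow hz, ?_, hpath'.isRainbow_pathMove hL hrainbow hz rfl,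
    ?_, ⟨(e₁.trans e₂).symm.trans e⟩⟩
  · rintro (v | ⟨⟩)
    · exact hpath'.singleton_mem_pathMove (singleton_mem_mapFaces (hK.singleton_mem v))
    · exact hpath'.singleton_new_mem_pathMove hL hz
  · obtain ⟨s, hs, t, ht, hst, hsd, htd⟩ := hK.facets.mapFaces (.inl : V ↪ V ⊕ Unit)
    by_cases hws : .inl w ∈ s
    · exact ⟨t, hpath'.mem_pathMove hrainbow ht (Finset.disjoint_left.mp hst hws), htd⟩
    · exact ⟨s, hpath'.mem_pathMove hrainbow hs hws, hsd⟩

theorem HasPathModel.add_two_mul (h : HasPathModel X d N) (hd : 3 ≤ d) (j : ℕ) :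
    HasPathModel X d (N + 2 * j) := by
  induction j with
  | zero => exact h
  | succ j ih => exact ih.hasRainbowModel.hasPathModel hd

theorem HasPathModel.hasBalancedTriangulation_add (h : HasPathModel X d N) (hd : 3 ≤ d) (k : ℕ) :
    HasBalancedTriangulation X d (N + k) := by
  obtain ⟨j, rfl | rfl⟩ := k.even_or_odd'
  · exact (h.add_two_mul hd j).hasRainbowModel.hasBalancedTriangulation
  · exact (h.add_two_mul hd j).hasBalancedTriangulation_succ

theorem HasBalancedTriangulation.congr {Y : Type*} [TopologicalSpace Y]
    (h : HasBalancedTriangulation X d N) (e : X ≃ₜ Y) : HasBalancedTriangulation Y d N := by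
  obtain ⟨V, i, K, κ, hN, hK, hv, hκ, hs, ⟨e'⟩⟩ := h
  exact ⟨V, i, K, κ, hN, hK, hv, hκ, hs, ⟨e'.trans e⟩⟩

end Models

section MappingTori

theorem hasPathModel_mappingTorus_one (m : ℕ) :
    HasPathModel (MappingTorus (sphereReflection (m + 1))^[m + 2]) (m + 3)
      (3 * (m + 3) + 2) :=
  HasRainbowModel.hasPathModel ⟨_, inferInstance, inferInstance, _, Prod.snd, by simp,
    ⟨isLowerSet_crossTorus _, singleton_mem_crossTorus _, isRainbow_crossTorus _,
      hasDisjointFacets_crossTorus _⟩, nonempty_homeomorph_crossTorus_one m⟩ (by lia)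

theorem hasPathModel_mappingTorus_swap (m : ℕ) :
    HasPathModel (MappingTorus (sphereReflection (m + 1))^[m + 3]) (m + 3)
      (3 * (m + 3) + 2) := by
  let κ : (Fin 3 × Fin (m + 3)) ⊕ Fin 2 → Fin (m + 3) := Sum.elim Prod.snd ![1, 0]
  have hK := isLowerSet_crossTorus (Equiv.swap (0 : Fin (m + 3)) 1)
  have hL : IsLowerSet (addTwo _) := isLowerSet_mapFaces _ hK
  obtain ⟨k, hk₀, hk₁⟩ := Fin.exists_ne_and_ne_of_two_lt (0 : Fin (m + 3)) 1 (by lia)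
  have htwist := (isTwistedRainbow_crossTorus zero_ne_one hk₀.symm hk₁.symm).mapFaces .inl
    (κ' := κ) fun _ => rfl
  have hu := singleton_inr_notMem_addTwo (K := crossTorus (Equiv.swap (0 : Fin (m + 3)) 1)) 0
  have hv := singleton_inr_notMem_addTwo (K := crossTorus (Equiv.swap (0 : Fin (m + 3)) 1)) 1
  have hedge := htwist.defect₁.edge
  obtain ⟨e⟩ := nonempty_homeomorph_crossTorus_swap m
  obtain ⟨e'⟩ := nonempty_homeomorph_subdivideTwice hK hedge htwist.edge_mem_stellar
  exact ⟨_, inferInstance, inferInstance, _, κ, by simp, isRainbowModel_subdivideTwice hK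
    (singleton_mem_crossTorus _) (hasDisjointFacets_crossTorus _) hedge htwist.edge_mem_stellar
    htwist.defect₁.ne htwist.defect₂.ne (htwist.isRainbow hL hu hv rfl rfl), ⟨e'.symm.trans e⟩,
    _, _, _, _, _, htwist.hasAlternatingPath hL hu hv (by simp) rfl rfl⟩

theorem hasPathModel_mappingTorus_id (m : ℕ) :
    HasPathModel (MappingTorus (id : UnitSphere (m + 1) → _)) (m + 3) (3 * (m + 3) + 2) := by
  obtain hm | hm := m.even_or_odd
  · exact (sphereReflection_involutive (m + 1)).iterate_even (hm.add even_two) ▸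
      hasPathModel_mappingTorus_one m
  · exact (sphereReflection_involutive (m + 1)).iterate_even (hm.add_odd (by decide : Odd 3)) ▸
      hasPathModel_mappingTorus_swap m

theorem hasPathModel_nonorientableSphereBundle (m : ℕ) :
    HasPathModel (NonorientableSphereBundle (m + 1)) (m + 3) (3 * (m + 3) + 2) := by
  obtain hm | hm := m.even_or_odd
  · have h := hasPathModel_mappingTorus_swap m
    rwa [(sphereReflection_involutive (m + 1)).iterate_odd (hm.add_odd (by decide : Odd 3))] at h
  · have h := hasPathModel_mappingTorus_one m
    rwa [(sphereReflection_involutive (m + 1)).iterate_odd (hm.add_even even_two)] at h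

end MappingTori

section Realization

variable {V : Type*} {K : Set (Finset V)}

/-- The abstract simplicial complex of the nonempty faces in a lower set that contains all
vertices. -/
def complexOfLowerSet (hK : IsLowerSet K) (hv : ∀ v, {v} ∈ K) : AbstractSimplicialComplex V where
  faces := {t | t ∈ K ∧ t.Nonempty}
  isRelLowerSet_faces _ ht := ⟨ht.2, fun _ hu hne => ⟨hK hu ht.1, hne⟩⟩
  singleton_mem v := ⟨hv v, Finset.singleton_nonempty v⟩

theorem realization_complexOfLowerSet [Fintype V] (hK : IsLowerSet K) (hv : ∀ v, {v} ∈ K) :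
    (complexOfLowerSet hK hv).realization = polyhedron K := by
  ext x
  refine ⟨fun ⟨hx, t, ht, htx⟩ => ⟨hx, t, ht.1, htx⟩, fun ⟨hx, t, ht, htx⟩ =>
    ⟨hx, t, ⟨ht, Finset.nonempty_iff_ne_empty.mpr ?_⟩, htx⟩⟩
  rintro rfl
  simpa [htx] using hx.2

theorem isBalanced_complexOfLowerSet {n : ℕ} {κ : V → Fin (n + 1)} (hK : IsLowerSet K)
    (hv : ∀ v, {v} ∈ K) (hκ : IsRainbow K κ) (hs : ∃ s ∈ K, s.card = n + 1) :
    (complexOfLowerSet hK hv).IsBalanced n := by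
  obtain ⟨s, hs, hsn⟩ := hs
  refine ⟨⟨⟨s, ⟨hs, Finset.card_pos.mp (by lia)⟩, hsn⟩, fun t ht => ?_⟩, κ, fun t ht => hκ t ht.1⟩
  simpa using Finset.card_le_card_of_injOn κ (fun _ _ => Finset.mem_univ _) (hκ t ht.1)

theorem HasBalancedTriangulation.exists_complex {X : Type*} [TopologicalSpace X] {n N : ℕ}
    (h : HasBalancedTriangulation X (n + 1) N) (hX : IsLocallyEuclidean n X) :
    ∃ K : AbstractSimplicialComplex (Fin N),
      K.IsBalanced n ∧ K.IsSimplicialManifold n ∧ K.Triangulates X := by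
  obtain ⟨V, _, K, κ, hN, hK, hv, hκ, ⟨s, hs, hsn⟩, ⟨e⟩⟩ := h
  let f : V ≃ Fin N := Fintype.equivFinOfCardEq hN
  have hL := isLowerSet_mapFaces f.toEmbedding hK
  have hw : ∀ w, {w} ∈ mapFaces f.toEmbedding K := fun w => by
    simpa using singleton_mem_mapFaces (f := f.toEmbedding) (hv (f.symm w))
  have hbal : (complexOfLowerSet hL hw).IsBalanced n :=
    isBalanced_complexOfLowerSet hL hw (hκ.mapFaces f.toEmbedding (κ' := κ ∘ f.symm) (by simp))
      ⟨_, ⟨s, hs, rfl⟩, (s.card_map _).trans hsn⟩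
  obtain ⟨e'⟩ := nonempty_homeomorph_mapFaces f.toEmbedding K
  let E : (complexOfLowerSet hL hw).realization ≃ₜ X :=
    (Homeomorph.setCongr (realization_complexOfLowerSet hL hw)).trans (e'.symm.trans e)
  exact ⟨_, hbal, ⟨hbal.1, inferInstance, inferInstance, hX.of_isOpenEmbedding E.isOpenEmbedding⟩,
    ⟨E⟩⟩

end Realization

theorem theorem6p9 (d k : ℕ) (hd : 3 ≤ d) (hk : 2 ≤ k) :
    (∃ K : AbstractSimplicialComplex (Fin (3 * d + k)),
      K.IsBalanced (d - 1) ∧ K.IsSimplicialManifold (d - 1) ∧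
        K.Triangulates (UnitSphere (d - 2) × Circle)) ∧
    (∃ K : AbstractSimplicialComplex (Fin (3 * d + k)),
      K.IsBalanced (d - 1) ∧ K.IsSimplicialManifold (d - 1) ∧
        K.Triangulates (NonorientableSphereBundle (d - 2))) := by
  obtain ⟨m, rfl⟩ := Nat.exists_eq_add_of_le' hd
  obtain ⟨j, rfl⟩ := Nat.exists_eq_add_of_le' hk
  rw [show 3 * (m + 3) + (j + 2) = 3 * (m + 3) + 2 + j by lia]
  have hsphere := isLocallyEuclidean_unitSphere (m + 1)
  have htrivial := (hasPathModel_mappingTorus_id m).hasBalancedTriangulation_add hd j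
  have htwisted := (hasPathModel_nonorientableSphereBundle m).hasBalancedTriangulation_add hd j
  have : T2Space (UnitSphere (m + 1)) := IsEmbedding.subtypeVal.t2Space
  obtain ⟨e⟩ := MappingTorus.nonempty_homeomorph_prod_circle (X := UnitSphere (m + 1))
  have hprod := (hsphere.mappingTorus (Homeomorph.refl _)).of_isOpenEmbedding e.symm.isOpenEmbedding
  exact ⟨(htrivial.congr e).exists_complex hprod,
    htwisted.exists_complex (hsphere.mappingTorus (sphereReflectionHomeomorph (m + 1)))⟩
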